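/- Let $n\ge 2$, $a<b$, let $\gamma\in C^\infty([a,b];\mathbb R^n)$ be parametrized by arc-length ($|\gamma'|\equiv 1$), let $\varrho\in C^\infty([a,b];\mathbb R_{>0})$ be its bending stiffness, and let $T=\gamma'$. For a curve $c$ with unit tangent $T_c=c'/|c'|$ and $\frac{d}{ds}=\frac1{|c'|}\frac{d}{dx}$, $ds=|c'|\,dx$, put $\mathcal B_\varrho(c)=\frac12\int_a^b\varrho\,\langle\frac{dT_c}{ds},\frac{dT_c}{ds}\rangle\,ds$. A variation of $\gamma$ is a family $(\gamma_t)_{t\in[-\varepsilon,\varepsilon]}$, jointly smooth on $[-\varepsilon,\varepsilon]\times[a,b]$, with $\gamma_0=\gamma$ and $\gamma_t=\gamma$ on $[a,a+\delta]\cup[b-\delta,b]$ for all $t$ and some $\delta>0$. The curve $\gamma$ is *elastic* (with bending stiffness $\varrho$) if $\frac{d}{dt}\big|_{t=0}\mathcal B_\varrho(\gamma_t)=0$ for every variation all of whose curves $\gamma_t$ are parametrized by arc-length. A function $\Lambda\in C^\infty([a,b])$ is a *pointwise multiplier* of $\gamma$ if $\gamma$ is a critical point, under all variations, of $\mathcal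 B_\varrho(\cdot)+\frac12\int_a^b\Lambda\,(\langle\gamma',\gamma'\rangle-1)\,dx$. Then: 1. $\gamma$ is elastic if and only if there is a constant vector $\mathbf a\in\mathbb R^n$ with $$\varrho T''+\varrho' T'-\varrho\langle T'',T\rangle T=\mathbf a-\langle\mathbf a,T\rangle T\quad\text{on }[a,b].\qquad(*)$$ 2. A function $\Lambda\in C^\infty([a,b])$ is a pointwise multiplier of $\gamma$ if and only if $\Lambda=\frac12\varrho\langle T',T'\rangle-\langle\mathbf a,T\rangle$ for some $\mathbf a\in\mathbb R^n$ satisfying $(*)$. Here $\frac12\varrho\langle T',T'\rangle-\langle\mathbf a,T\rangle=\frac12\varrho\langle\kappa,\kappa\rangle-\langle\mathbf a,T\rangle$ for every curvature function $\kappa\in C^\infty([a,b];\mathbb R^{n-1})$ of $\gamma$, i.e. $T'=-N\kappa$, where $N=[N_1,\dots,N_{n-1}]$ consists of unit normal fields that are parallel ($N_j'=\lambda_j T$ with $\lambda_j\in C^\infty([a,b])$) with $\det(T,N_1,\dots,N_{n-1})=1$. 3. If $\varrho$ is constant, then every pointwise multiplier $\Lambda$ is constant. 4. Let $n=2$, let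 $(e_1,e_2)$ be an orthonormal basis of $\mathbb R^2$ and let $\theta\in C^\infty([a,b])$ satisfy $T=\sin\theta\,e_1-\cos\theta\,e_2$. For $q\in\mathbb R$, equation $(*)$ with $\mathbf a=-q\,e_2$ holds if and only if $$\theta''=-\tfrac{q}{\varrho}\sin\theta-\tfrac{\varrho'}{\varrho}\theta'\quad\text{on }[a,b].$$ If $\varrho=\ell^2$ and $q=g\ell$ with a smooth $\ell>0$ and a function $g$ on $[a,b]$, this is equivalent to the variable-length pendulum equation $\theta''=-\frac{g}{\ell}\sin\theta-2\frac{\ell'}{\ell}\theta'$. Moreover, a planar $\gamma$ is elastic if and only if there are such $(e_1,e_2)$ and $\theta$, and a $q\in\mathbb R$, for which the damped pendulum equation holds. -/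

import Mathlib

open Set
open scoped ContDiff RealInnerProductSpace

namespace ElasticCurve

noncomputable section

/-- The derivative `f'` of a function on the interval `[a, b]` (one-sided at the end points). -/
def derivOn {F : Type*} [NormedAddCommGroup F] [NormedSpace ℝ F] (a b : ℝ) (f : ℝ → F) : ℝ → F :=
  fun x => derivWithin f (Icc a b) x

/-- `f ∈ C^∞([a, b]; F)`. -/
def SmoothOn {F : Type*} [NormedAddCommGroup F] [NormedSpace ℝ F] (a b : ℝ) (f : ℝ → F) : Prop :=
  ContDiffOn ℝ ∞ f (Icc a b)

/-- The derivative `dg/ds = g' / |γ'|` of `g` with respect to the arc-length of `γ`. -/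
def arcDeriv {n : ℕ} {F : Type*} [NormedAddCommGroup F] [NormedSpace ℝ F] (a b : ℝ)
    (γ : ℝ → EuclideanSpace ℝ (Fin n)) (g : ℝ → F) : ℝ → F :=
  fun x => ‖derivOn a b γ x‖⁻¹ • derivOn a b g x

/-- The unit tangent field `T = dγ/ds`. -/
def unitTangent {n : ℕ} (a b : ℝ) (γ : ℝ → EuclideanSpace ℝ (Fin n)) :
    ℝ → EuclideanSpace ℝ (Fin n) :=
  arcDeriv a b γ γ

/-- `γ ∈ C^∞([a, b]; ℝⁿ)` is parametrized by arc-length: `|γ'| ≡ 1`. -/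
structure IsArcLengthCurve {n : ℕ} (a b : ℝ) (γ : ℝ → EuclideanSpace ℝ (Fin n)) : Prop where
  smooth : SmoothOn a b γ
  unit_speed : ∀ x ∈ Icc a b, ‖derivOn a b γ x‖ = 1

/-- `ϱ ∈ C^∞([a, b]; ℝ_{>0})`. -/
structure IsStiffness (a b : ℝ) (ϱ : ℝ → ℝ) : Prop where
  smooth : SmoothOn a b ϱ
  pos : ∀ x ∈ Icc a b, 0 < ϱ x

/-- The bending energy `½ ∫_a^b ϱ ⟨dT/ds, dT/ds⟩ ds` with bending stiffness `ϱ`,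
where `ds = |γ'| dx`. -/
def bendingEnergy {n : ℕ} (a b : ℝ) (ϱ : ℝ → ℝ) (γ : ℝ → EuclideanSpace ℝ (Fin n)) : ℝ :=
  (1 / 2) * ∫ x in a..b,
    ϱ x * ⟪arcDeriv a b γ (unitTangent a b γ) x, arcDeriv a b γ (unitTangent a b γ) x⟫
      * ‖derivOn a b γ x‖

/-- `Γ t`, `t ∈ [-ε, ε]`, is a smooth variation of `γ` with compact support in the interior
of `[a, b]`. -/
structure IsVariation {n : ℕ} (a b : ℝ) (γ : ℝ → EuclideanSpace ℝ (Fin n)) (ε : ℝ)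
    (Γ : ℝ → ℝ → EuclideanSpace ℝ (Fin n)) : Prop where
  eps_pos : 0 < ε
  smooth : ContDiffOn ℝ ∞ (fun p : ℝ × ℝ => Γ p.1 p.2) (Icc (-ε) ε ×ˢ Icc a b)
  at_zero : ∀ x ∈ Icc a b, Γ 0 x = γ x
  compact_support : ∃ δ > 0, ∀ t ∈ Icc (-ε) ε, ∀ x ∈ Icc a b,
    (x ≤ a + δ ∨ b - δ ≤ x) → Γ t x = γ x

/-- `γ` is elastic with bending stiffness `ϱ`: it is a critical point of the bending energy under
all smooth variations, with compact support in the interior of `[a, b]`, through curves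
parametrized by arc-length. -/
def IsElastic {n : ℕ} (a b : ℝ) (ϱ : ℝ → ℝ) (γ : ℝ → EuclideanSpace ℝ (Fin n)) : Prop :=
  ∀ (ε : ℝ) (Γ : ℝ → ℝ → EuclideanSpace ℝ (Fin n)), IsVariation a b γ ε Γ →
    (∀ t ∈ Icc (-ε) ε, ∀ x ∈ Icc a b, ‖derivOn a b (Γ t) x‖ = 1) →
    HasDerivAt (fun t => bendingEnergy a b ϱ (Γ t)) 0 0

/-- The bending energy augmented by the arc-length constraint,
`½ ∫_a^b ϱ ⟨dT/ds, dT/ds⟩ ds + ½ ∫_a^b Λ (⟨γ', γ'⟩ - 1) dx`. -/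
def augmentedEnergy {n : ℕ} (a b : ℝ) (ϱ Λ : ℝ → ℝ) (γ : ℝ → EuclideanSpace ℝ (Fin n)) : ℝ :=
  bendingEnergy a b ϱ γ
    + (1 / 2) * ∫ x in a..b, Λ x * (⟪derivOn a b γ x, derivOn a b γ x⟫ - 1)

/-- `Λ ∈ C^∞([a, b])` is a pointwise Lagrange multiplier for the arc-length constraint at `γ`:
`γ` is a critical point of the augmented energy under all smooth variations with compact support
in the interior of `[a, b]`. With the factor `½` in front of `Λ` the Euler-Lagrange equation is
`ϱT''' + 3ϱ⟨T',T''⟩T + (3/2)ϱ⟨T',T'⟩T' + ϱ''T' + 2ϱ'T'' + (3/2)ϱ'⟨T',T'⟩T - Λ'T - ΛT' = 0`. -/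
structure IsMultiplier {n : ℕ} (a b : ℝ) (ϱ : ℝ → ℝ) (γ : ℝ → EuclideanSpace ℝ (Fin n))
    (Λ : ℝ → ℝ) : Prop where
  smooth : SmoothOn a b Λ
  critical : ∀ (ε : ℝ) (Γ : ℝ → ℝ → EuclideanSpace ℝ (Fin n)), IsVariation a b γ ε Γ →
    HasDerivAt (fun t => augmentedEnergy a b ϱ Λ (Γ t)) 0 0

/-- The equation `ϱT'' + ϱ'T' - ϱ⟨T'', T⟩T = A - ⟨A, T⟩T` on `[a, b]`. -/
def PendulumEq {n : ℕ} (a b : ℝ) (ϱ : ℝ → ℝ) (T : ℝ → EuclideanSpace ℝ (Fin n))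
    (A : EuclideanSpace ℝ (Fin n)) : Prop :=
  ∀ x ∈ Icc a b,
    ϱ x • derivOn a b (derivOn a b T) x + derivOn a b ϱ x • derivOn a b T x
      - (ϱ x * ⟪derivOn a b (derivOn a b T) x, T x⟫) • T x
    = A - ⟪A, T x⟫ • T x

/-- `N = [N₁, …, N_{n-1}]` consists of parallel unit normal fields along `γ` with
`det (T, N₁, …, N_{n-1}) = 1` (unit vectors with determinant `1` are orthonormal). -/
structure IsParallelFrame {n : ℕ} (a b : ℝ) (γ : ℝ → EuclideanSpace ℝ (Fin n))
    (N : Fin (n - 1) → ℝ → EuclideanSpace ℝ (Fin n)) : Prop where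
  smooth : ∀ j, SmoothOn a b (N j)
  orthonormal : ∀ x ∈ Icc a b, Orthonormal ℝ (fun j => N j x)
  normal : ∀ j, ∀ x ∈ Icc a b, ⟪N j x, unitTangent a b γ x⟫ = 0
  parallel : ∀ j, ∃ l : ℝ → ℝ, SmoothOn a b l ∧
    ∀ x ∈ Icc a b, derivOn a b (N j) x = l x • unitTangent a b γ x
  det_eq_one : ∀ x ∈ Icc a b,
    (Matrix.of fun i j : Fin n =>
      if h : (j : ℕ) = 0 then unitTangent a b γ x i
      else N ⟨(j : ℕ) - 1, by omega⟩ x i).det = 1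

/-- `κ ∈ C^∞([a, b]; ℝ^{n-1})` is a curvature function of `γ`: `T' = -Nκ` for a parallel
frame `N` as above. -/
structure IsCurvatureFunction {n : ℕ} (a b : ℝ) (γ : ℝ → EuclideanSpace ℝ (Fin n))
    (κ : ℝ → EuclideanSpace ℝ (Fin (n - 1))) : Prop where
  smooth : SmoothOn a b κ
  exists_frame : ∃ N : Fin (n - 1) → ℝ → EuclideanSpace ℝ (Fin n), IsParallelFrame a b γ N ∧
    ∀ x ∈ Icc a b, derivOn a b (unitTangent a b γ) x = -∑ j, κ x j • N j x

/-- `θ` is a smooth tangent angle of a planar curve with respect to the orthonormal basis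
`e = (e₁, e₂)` of the plane: `T = sin θ e₁ - cos θ e₂`. -/
structure IsTangentAngle {n : ℕ} (a b : ℝ) (γ : ℝ → EuclideanSpace ℝ (Fin n))
    (e : OrthonormalBasis (Fin 2) ℝ (EuclideanSpace ℝ (Fin n))) (θ : ℝ → ℝ) : Prop where
  smooth : SmoothOn a b θ
  eq : ∀ x ∈ Icc a b, unitTangent a b γ x = Real.sin (θ x) • e 0 - Real.cos (θ x) • e 1

/-- The damped pendulum equation `θ'' = -(q/ϱ) sin θ - (ϱ'/ϱ) θ'` on `[a, b]`. -/
def DampedPendulumEq (a b : ℝ) (ϱ : ℝ → ℝ) (q : ℝ) (θ : ℝ → ℝ) : Prop :=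
  ∀ x ∈ Icc a b, derivOn a b (derivOn a b θ) x
    = -(q / ϱ x) * Real.sin (θ x) - derivOn a b ϱ x / ϱ x * derivOn a b θ x

/-- The equation `θ'' = -(g/l) sin θ - 2 (l'/l) θ'` on `[a, b]` of a pendulum with variable
rod length `l`. -/
def VariableLengthPendulumEq (a b : ℝ) (l g : ℝ → ℝ) (θ : ℝ → ℝ) : Prop :=
  ∀ x ∈ Icc a b, derivOn a b (derivOn a b θ) x
    = -(g x / l x) * Real.sin (θ x) - 2 * (derivOn a b l x / l x) * derivOn a b θ x

end

end ElasticCurve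

open ElasticCurve

/-! Write `T = γ'`. After one integration by parts the first variation of the augmented energy is `∫
⟪G, D⟫`, where `D` is the velocity of the tangent and `G = (Λ - 3/2 ϱ|T'|²) T - (ϱT')'` is
`energyGradient`. Under unconstrained variations `D` is the derivative of a compactly supported
field, so by du Bois-Reymond `Λ` is a multiplier iff `G` is a constant `-A`. The tangential part of
`G = -A` is the formula for `Λ`, the normal part is (*): this is `energyGradient_eq_neg_iff`.

A solution of (*) is elastic because its multiplier term vanishes on unit speed curves.

For the converse, the admissible `D` must be identified: every compactly supported normal field `V`
with `∫ V = 0` occurs. In `exists_isVariation_of_family` the tangent `T + tV + W s` is normalized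
and integrated, and the correction `s = s(t)` that keeps the end point fixed comes from the implicit
function theorem. This needs a right inverse `W` of `V ↦ ∫ V`, which exists unless `T' = 0`
throughout; then `A = 0` works. Criticality now says that `V ↦ ∫ ⟪G, V⟫`, with `Λ = 0`, vanishes on
the kernel of `V ↦ ∫ V`, hence equals `⟪B, ∫ V⟫` for some `B`. So `G - B` is tangential, which is
(*) with `A = -B`.

For constant `ϱ`, pairing (*) with `T'` gives `Λ' = 0`. In the plane both sides of (*) are multiples
of the unit normal, and comparing coefficients gives the damped pendulum. -/

open Filter Topology MeasureTheory Interval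

namespace ElasticCurve

/-! ### Calculus on a compact interval and for smooth families -/

section Calculus

variable {F : Type*} [NormedAddCommGroup F] [NormedSpace ℝ F] {a b : ℝ}

theorem SmoothOn.derivOn (hab : a < b) {f : ℝ → F} (hf : SmoothOn a b f) :
    SmoothOn a b (derivOn a b f) :=
  ((contDiffOn_infty_iff_derivWithin (uniqueDiffOn_Icc hab)).1 hf).2

theorem SmoothOn.hasDerivWithinAt {f : ℝ → F} (hf : SmoothOn a b f) {x : ℝ} (hx : x ∈ Icc a b) :
    HasDerivWithinAt f (ElasticCurve.derivOn a b f x) (Icc a b) x :=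
  ((hf x hx).differentiableWithinAt (by simp)).hasDerivWithinAt

theorem derivOn_eq (hab : a < b) {f : ℝ → F} {f' : F} {x : ℝ} (hx : x ∈ Icc a b)
    (h : HasDerivWithinAt f f' (Icc a b) x) : derivOn a b f x = f' :=
  h.derivWithin (uniqueDiffOn_Icc hab x hx)

theorem derivOn_congr {f g : ℝ → F} (h : EqOn f g (Icc a b)) {x : ℝ} (hx : x ∈ Icc a b) :
    derivOn a b f x = derivOn a b g x :=
  derivWithin_congr h (h hx)

theorem SmoothOn.congr {f g : ℝ → F} (hf : SmoothOn a b f) (h : EqOn g f (Icc a b)) :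
    SmoothOn a b g :=
  ContDiffOn.congr hf h

/-- A smooth function whose derivative vanishes is constant. -/
theorem SmoothOn.eq_left_of_derivOn_eq_zero {f : ℝ → F} (hf : SmoothOn a b f)
    (h : ∀ x ∈ Icc a b, ElasticCurve.derivOn a b f x = 0) : ∀ x ∈ Icc a b, f x = f a :=
  constant_of_derivWithin_zero (hf.differentiableOn (by simp))
    fun x hx => h x (Ico_subset_Icc_self hx)

theorem uniqueDiffOn_rectangle {ε : ℝ} (hε : 0 < ε) (hab : a < b) :
    UniqueDiffOn ℝ (Icc (-ε) ε ×ˢ Icc a b) :=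
  (uniqueDiffOn_Icc (by linarith)).prod (uniqueDiffOn_Icc hab)

variable {ε : ℝ} {f : ℝ → ℝ → F}

/-- The partial derivative in the second variable, as a value of the Fréchet derivative. -/
theorem derivOn_eq_fderivWithin (hab : a < b)
    (hf : ContDiffOn ℝ ∞ (fun p : ℝ × ℝ => f p.1 p.2) (Icc (-ε) ε ×ˢ Icc a b)) {t x : ℝ}
    (ht : t ∈ Icc (-ε) ε) (hx : x ∈ Icc a b) :
    derivOn a b (f t) x
      = fderivWithin ℝ (fun p : ℝ × ℝ => f p.1 p.2) (Icc (-ε) ε ×ˢ Icc a b) (t, x) (0, 1) := by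
  apply derivOn_eq hab hx
  have h1 := ((hf (t, x) ⟨ht, hx⟩).differentiableWithinAt (by simp)).hasFDerivWithinAt
  have h2 : HasDerivWithinAt (fun y : ℝ => (t, y)) ((0 : ℝ), (1 : ℝ)) (Icc a b) x :=
    (hasDerivWithinAt_const _ _ _).prodMk (hasDerivWithinAt_id _ _)
  exact h1.comp_hasDerivWithinAt x h2 fun y hy => (⟨ht, hy⟩ : (t, y) ∈ Icc (-ε) ε ×ˢ Icc a b)

/-- The partial derivative in the first variable, as a value of the Fréchet derivative. -/
theorem hasDerivAt_fst
    (hf : ContDiffOn ℝ ∞ (fun p : ℝ × ℝ => f p.1 p.2) (Icc (-ε) ε ×ˢ Icc a b)) {t x : ℝ}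
    (ht : t ∈ Ioo (-ε) ε) (hx : x ∈ Icc a b) :
    HasDerivAt (fun s => f s x)
      (fderivWithin ℝ (fun p : ℝ × ℝ => f p.1 p.2) (Icc (-ε) ε ×ˢ Icc a b) (t, x) (1, 0)) t := by
  have h1 := ((hf (t, x) ⟨Ioo_subset_Icc_self ht, hx⟩).differentiableWithinAt
    (by simp)).hasFDerivWithinAt
  have h2 : HasDerivWithinAt (fun s : ℝ => (s, x)) ((1 : ℝ), (0 : ℝ)) (Icc (-ε) ε) t :=
    (hasDerivWithinAt_id _ _).prodMk (hasDerivWithinAt_const _ _ _)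
  exact (h1.comp_hasDerivWithinAt t h2 fun s hs =>
    (⟨hs, hx⟩ : (s, x) ∈ Icc (-ε) ε ×ˢ Icc a b)).hasDerivAt (Icc_mem_nhds ht.1 ht.2)

theorem contDiffOn_fderivWithin_apply (hε : 0 < ε) (hab : a < b)
    (hf : ContDiffOn ℝ ∞ (fun p : ℝ × ℝ => f p.1 p.2) (Icc (-ε) ε ×ˢ Icc a b)) (w : ℝ × ℝ) :
    ContDiffOn ℝ ∞ (fun q => fderivWithin ℝ (fun p : ℝ × ℝ => f p.1 p.2)
      (Icc (-ε) ε ×ˢ Icc a b) q w) (Icc (-ε) ε ×ˢ Icc a b) :=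
  (hf.fderivWithin (uniqueDiffOn_rectangle hε hab) (m := ∞) (by simp)).clm_apply contDiffOn_const

theorem contDiffOn_derivOn (hε : 0 < ε) (hab : a < b)
    (hf : ContDiffOn ℝ ∞ (fun p : ℝ × ℝ => f p.1 p.2) (Icc (-ε) ε ×ˢ Icc a b)) :
    ContDiffOn ℝ ∞ (fun p : ℝ × ℝ => derivOn a b (f p.1) p.2) (Icc (-ε) ε ×ˢ Icc a b) :=
  (contDiffOn_fderivWithin_apply hε hab hf (0, 1)).congr fun _ hp =>
    derivOn_eq_fderivWithin hab hf hp.1 hp.2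

theorem smoothOn_slice
    (hf : ContDiffOn ℝ ∞ (fun p : ℝ × ℝ => f p.1 p.2) (Icc (-ε) ε ×ˢ Icc a b)) {t : ℝ}
    (ht : t ∈ Icc (-ε) ε) : SmoothOn a b (f t) :=
  hf.comp (f := fun x => (t, x)) (by fun_prop) fun x hx => ⟨ht, hx⟩

/-- The initial velocity of a smooth family is smooth. -/
theorem smoothOn_velocity (hε : 0 < ε) (hab : a < b)
    (hf : ContDiffOn ℝ ∞ (fun p : ℝ × ℝ => f p.1 p.2) (Icc (-ε) ε ×ˢ Icc a b)) {g : ℝ → F}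
    (hg : ∀ x ∈ Icc a b, HasDerivAt (fun t => f t x) (g x) 0) : SmoothOn a b g := by
  have h := (contDiffOn_fderivWithin_apply hε hab hf (1, 0)).comp
    (f := fun x => ((0 : ℝ), x)) (s := Icc a b) (by fun_prop) fun x hx => ⟨by simp [hε.le], hx⟩
  exact h.congr fun x hx => (hg x hx).unique (hasDerivAt_fst hf (by simp [hε]) hx)

/-- The partial derivatives of a smooth family commute. -/
theorem hasDerivAt_derivOn (hε : 0 < ε) (hab : a < b)
    (hf : ContDiffOn ℝ ∞ (fun p : ℝ × ℝ => f p.1 p.2) (Icc (-ε) ε ×ˢ Icc a b)) {g : ℝ → F}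
    (hg : ∀ x ∈ Icc a b, HasDerivAt (fun t => f t x) (g x) 0) {x : ℝ} (hx : x ∈ Icc a b) :
    HasDerivAt (fun t => derivOn a b (f t) x) (derivOn a b g x) 0 := by
  set R := Icc (-ε) ε ×ˢ Icc a b with hR
  set u : ℝ × ℝ → F := fun p => f p.1 p.2 with hu
  have h0 : (0 : ℝ) ∈ Ioo (-ε) ε := by simp [hε]
  have h0R : ((0 : ℝ), x) ∈ R := ⟨Ioo_subset_Icc_self h0, hx⟩
  have hU := uniqueDiffOn_rectangle hε hab
  -- Symmetry persists at boundary points `x = a, b`, since the rectangle is the closure of its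
  -- interior.
  have hsymm : IsSymmSndFDerivWithinAt ℝ u R (0, x) := by
    refine (hf (0, x) h0R).isSymmSndFDerivWithinAt
      (by simpa using WithTop.coe_le_coe.2 (le_top : (2 : ℕ∞) ≤ ⊤)) hU ?_ h0R
    rw [hR, interior_prod_eq, interior_Icc, interior_Icc, closure_prod_eq,
      closure_Ioo (by linarith), closure_Ioo hab.ne]
    exact h0R
  have hdiff : DifferentiableWithinAt ℝ (fderivWithin ℝ u R) R (0, x) :=
    ((hf.fderivWithin hU (m := ∞) (by simp)) _ h0R).differentiableWithinAt (by simp)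
  have happ : ∀ w v : ℝ × ℝ, fderivWithin ℝ (fun p => fderivWithin ℝ u R p w) R (0, x) v
      = fderivWithin ℝ (fderivWithin ℝ u R) R (0, x) v w := by
    intro w v
    have := hdiff.hasFDerivWithinAt.clm_apply (hasFDerivWithinAt_const w (0, x) R)
    rw [this.fderivWithin (hU _ h0R)]
    simp
  have h1 : HasDerivAt (fun t => derivOn a b (f t) x)
      (fderivWithin ℝ (fun p => fderivWithin ℝ u R p (0, 1)) R (0, x) (1, 0)) 0 := by
    have := hasDerivAt_fst (f := fun t y => fderivWithin ℝ u R (t, y) (0, 1))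
      (contDiffOn_fderivWithin_apply hε hab hf (0, 1)) h0 hx
    refine this.congr_of_eventuallyEq ?_
    filter_upwards [Icc_mem_nhds h0.1 h0.2] with t ht
    exact derivOn_eq_fderivWithin hab hf ht hx
  have h2 : derivOn a b g x
      = fderivWithin ℝ (fun p => fderivWithin ℝ u R p (1, 0)) R (0, x) (0, 1) := by
    rw [← derivOn_eq_fderivWithin (f := fun t y => fderivWithin ℝ u R (t, y) (1, 0)) hab
      (contDiffOn_fderivWithin_apply hε hab hf (1, 0)) (Ioo_subset_Icc_self h0) hx]
    exact derivOn_congr (fun y hy => (hg y hy).unique (hasDerivAt_fst hf h0 hy)) hx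
  rw [h2, happ, hsymm.eq, ← happ]
  exact h1

/-- Differentiation under the integral sign for a smooth family. -/
theorem hasDerivAt_integral_of_contDiffOn (hε : 0 < ε) (hab : a < b)
    (hf : ContDiffOn ℝ ∞ (fun p : ℝ × ℝ => f p.1 p.2) (Icc (-ε) ε ×ˢ Icc a b)) {g : ℝ → F}
    (hg : ∀ x ∈ Icc a b, HasDerivAt (fun t => f t x) (g x) 0) :
    HasDerivAt (fun t => ∫ x in a..b, f t x) (∫ x in a..b, g x) 0 := by
  set R := Icc (-ε) ε ×ˢ Icc a b with hR
  set u' : ℝ → ℝ → F := fun t x => fderivWithin ℝ (fun p : ℝ × ℝ => f p.1 p.2) R (t, x) (1, 0)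
  have hu' : ContDiffOn ℝ ∞ (fun p : ℝ × ℝ => u' p.1 p.2) R :=
    contDiffOn_fderivWithin_apply hε hab hf (1, 0)
  have h0 : (0 : ℝ) ∈ Ioo (-ε) ε := by simp [hε]
  -- Compactness of the rectangle supplies a constant dominating function.
  obtain ⟨C, hC⟩ := (isCompact_Icc.prod isCompact_Icc).exists_bound_of_continuousOn
    hu'.continuousOn
  have hI : Ι a b ⊆ Icc a b := by rw [uIoc_of_le hab.le]; exact Ioc_subset_Icc_self
  have hmeas : ∀ h : ℝ → F, SmoothOn a b h → AEStronglyMeasurable h (volume.restrict (Ι a b)) :=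
    fun h hh => ((ContDiffOn.continuousOn hh).mono hI).aestronglyMeasurable measurableSet_uIoc
  have key := intervalIntegral.hasDerivAt_integral_of_dominated_loc_of_deriv_le (μ := volume)
    (F := f) (F' := u') (x₀ := 0) (s := Ioo (-ε) ε) (a := a) (b := b) (bound := fun _ => C)
    (Ioo_mem_nhds h0.1 h0.2)
    (by
      filter_upwards [Icc_mem_nhds h0.1 h0.2] with t ht
      exact hmeas _ (smoothOn_slice hf ht))
    ((smoothOn_slice hf (Ioo_subset_Icc_self h0)).continuousOn.intervalIntegrable_of_Icc hab.le)
    (hmeas _ (smoothOn_slice hu' (Ioo_subset_Icc_self h0)))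
    (Eventually.of_forall fun x hx t ht => hC (t, x) ⟨Ioo_subset_Icc_self ht, hI hx⟩)
    intervalIntegrable_const
    (Eventually.of_forall fun x hx t ht => hasDerivAt_fst hf ht (hI hx))
  have hint : ∫ x in a..b, g x = ∫ x in a..b, u' 0 x := by
    refine intervalIntegral.integral_congr fun x hx => ?_
    rw [uIcc_of_le hab.le] at hx
    exact (hg x hx).unique (hasDerivAt_fst hf h0 hx)
  rw [hint]
  exact key.2

/-- The fundamental lemma of the calculus of variations. -/
theorem eqOn_zero_of_forall_integral_smul_eq_zero [CompleteSpace F] (hab : a < b) {h : ℝ → F}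
    (hh : ContinuousOn h (Icc a b))
    (H : ∀ φ : ℝ → ℝ, ContDiff ℝ ∞ φ → HasCompactSupport φ → tsupport φ ⊆ Ioo a b →
      ∫ x in a..b, φ x • h x = 0) : ∀ x ∈ Icc a b, h x = 0 := by
  have h1 : ∀ᵐ x ∂volume, x ∈ Ioo a b → h x = 0 := by
    refine isOpen_Ioo.ae_eq_zero_of_integral_contDiff_smul_eq_zero
      ((hh.locallyIntegrableOn measurableSet_Icc).mono_set Ioo_subset_Icc_self) ?_
    intro φ hφ hc hs
    rw [← H φ hφ hc hs, intervalIntegral.integral_of_le hab.le]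
    refine (setIntegral_eq_integral_of_forall_compl_eq_zero fun x hx => ?_).symm
    rw [image_eq_zero_of_notMem_tsupport fun hx' => hx (Ioo_subset_Ioc_self (hs hx')), zero_smul]
  -- The end points form a null set, and continuity upgrades a.e. vanishing to all of `[a, b]`.
  have h2 : h =ᵐ[volume.restrict (Icc a b)] fun _ => 0 := by
    rw [← restrict_Ioo_eq_restrict_Icc]
    exact (ae_restrict_iff' measurableSet_Ioo).2 h1
  exact Measure.eqOn_Icc_of_ae_eq volume hab.ne h2 hh continuousOn_const

/-- Integration by parts for the inner product. -/
theorem integral_inner_derivOn {E : Type*} [NormedAddCommGroup E] [InnerProductSpace ℝ E]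
    (hab : a < b) {u v : ℝ → E} (hu : SmoothOn a b u) (hv : SmoothOn a b v)
    (ha : v a = 0) (hb : v b = 0) :
    ∫ x in a..b, ⟪u x, derivOn a b v x⟫ = -∫ x in a..b, ⟪derivOn a b u x, v x⟫ := by
  have huv : SmoothOn a b fun x => ⟪u x, v x⟫ := ContDiffOn.inner ℝ hu hv
  have hd : ∀ x ∈ Icc a b, derivOn a b (fun x => ⟪u x, v x⟫) x
      = ⟪u x, derivOn a b v x⟫ + ⟪derivOn a b u x, v x⟫ := fun x hx =>
    derivOn_eq hab hx ((hu.hasDerivWithinAt hx).inner ℝ (hv.hasDerivWithinAt hx))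
  have h1 := intervalIntegral.integral_derivWithin_Icc_of_contDiffOn_Icc (huv.of_le (by simp))
    hab.le
  simp only [ha, hb, inner_zero_right, sub_zero] at h1
  rw [eq_neg_iff_add_eq_zero, ← intervalIntegral.integral_add, ← h1]
  · refine intervalIntegral.integral_congr fun x hx => ?_
    rw [uIcc_of_le hab.le] at hx
    exact (hd x hx).symm
  · exact (ContDiffOn.inner ℝ hu (hv.derivOn hab)).continuousOn.intervalIntegrable_of_Icc hab.le
  · exact (ContDiffOn.inner ℝ (hu.derivOn hab) hv).continuousOn.intervalIntegrable_of_Icc hab.le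

/-- A compact subset of an open interval stays away from the end points. -/
theorem exists_margin {K : Set ℝ} (hK : IsCompact K) (hKab : K ⊆ Ioo a b) :
    ∃ δ > 0, ∀ x, (x ≤ a + δ ∨ b - δ ≤ x) → x ∉ K := by
  rcases K.eq_empty_or_nonempty with rfl | hne
  · exact ⟨1, one_pos, by simp⟩
  obtain ⟨p, hp, hpl⟩ := hK.exists_isLeast hne
  obtain ⟨q, hq, hqu⟩ := hK.exists_isGreatest hne
  refine ⟨min ((p - a) / 2) ((b - q) / 2), ?_, fun x hx hxK => ?_⟩
  · have := (hKab hp).1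
    have := (hKab hq).2
    exact lt_min (by linarith) (by linarith)
  · have h1 := hpl hxK
    have h2 := hqu hxK
    have h3 := (hKab hp).1
    have h4 := (hKab hq).2
    have h5 := min_le_left ((p - a) / 2) ((b - q) / 2)
    have h6 := min_le_right ((p - a) / 2) ((b - q) / 2)
    rcases hx with hx | hx <;> linarith

/-- A smooth function on `[a, b]` can be extended smoothly to the line without changing it on a
given compact subset of the interior. -/
theorem SmoothOn.exists_contDiff_eqOn (hab : a < b) {f : ℝ → F} (hf : SmoothOn a b f) {K : Set ℝ}
    (hK : IsCompact K) (hKab : K ⊆ Ioo a b) :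
    ∃ g : ℝ → F, ContDiff ℝ ∞ g ∧ EqOn g f K := by
  obtain ⟨δ₀, hδ₀, hK₀⟩ := exists_margin hK hKab
  obtain ⟨δ, hδ, hδ1, hδ2⟩ : ∃ δ > 0, δ ≤ δ₀ ∧ δ ≤ (b - a) / 4 :=
    ⟨min δ₀ ((b - a) / 4), lt_min hδ₀ (by linarith), min_le_left _ _, min_le_right _ _⟩
  -- The cutoff is `1` on `[a + δ, b - δ] ⊇ K` and supported in `[a + δ/2, b - δ/2]`; `δ ≤ (b -
  -- a)/4` keeps the inner radius positive.
  let χ : ContDiffBump ((a + b) / 2) := ⟨(b - a) / 2 - δ, (b - a) / 2 - δ / 2,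
    by linarith, by linarith⟩
  have hχ : ContDiff ℝ ∞ χ := χ.contDiff
  have hχs : tsupport χ ⊆ Ioo a b := by
    rw [χ.tsupport_eq]
    intro x hx
    rw [Real.closedBall_eq_Icc] at hx
    exact ⟨by have := hx.1; simp only [χ] at this; linarith,
      by have := hx.2; simp only [χ] at this; linarith⟩
  have hχ1 : ∀ x ∈ K, χ x = 1 := fun x hx => by
    apply χ.one_of_mem_closedBall
    rw [Real.closedBall_eq_Icc]
    have := hK₀ x
    simp only [χ]
    constructor <;> by_contra! h
    · exact this (Or.inl (by linarith)) hx
    · exact this (Or.inr (by linarith)) hx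
  refine ⟨fun x => χ x • f x, ?_, fun x hx => by simp [hχ1 x hx]⟩
  rw [contDiff_iff_contDiffAt]
  intro x
  by_cases hx : x ∈ Ioo a b
  · exact hχ.contDiffAt.smul (hf.contDiffAt (Icc_mem_nhds hx.1 hx.2))
  · have : (fun x => χ x • f x) =ᶠ[𝓝 x] fun _ => 0 := by
      have : (tsupport χ)ᶜ ∈ 𝓝 x :=
        (isClosed_tsupport χ).isOpen_compl.mem_nhds fun h => hx (hχs h)
      filter_upwards [this] with y hy
      rw [image_eq_zero_of_notMem_tsupport hy, zero_smul]
    exact contDiffAt_const.congr_of_eventuallyEq this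

end Calculus

/-! ### First variation of the augmented energy -/

section FirstVariation

variable {n : ℕ} {a b : ℝ}

theorem hasDerivWithinAt_norm {f : ℝ → EuclideanSpace ℝ (Fin n)} {f' : EuclideanSpace ℝ (Fin n)} {s : Set ℝ} {x : ℝ}
    (hf : HasDerivWithinAt f f' s x) (h0 : f x ≠ 0) :
    HasDerivWithinAt (fun y => ‖f y‖) (⟪f x, f'⟫ / ‖f x‖) s x := by
  have h1 : ⟪f x, f x⟫ ≠ 0 := inner_self_ne_zero.2 h0
  have h2 := (hf.inner ℝ hf).sqrt h1
  have h3 : ∀ y : EuclideanSpace ℝ (Fin n), √⟪y, y⟫ = ‖y‖ := fun y => by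
    rw [real_inner_self_eq_norm_sq, Real.sqrt_sq (norm_nonneg _)]
  simp only [h3] at h2
  convert h2 using 1
  rw [real_inner_comm (f x) f']
  ring

section UnitField

variable {T : ℝ → EuclideanSpace ℝ (Fin n)}

theorem inner_self_eq_one (h1 : ∀ x ∈ Icc a b, ‖T x‖ = 1) {x : ℝ} (hx : x ∈ Icc a b) :
    ⟪T x, T x⟫ = 1 := by
  rw [real_inner_self_eq_norm_sq, h1 x hx, one_pow]

theorem inner_derivOn_self (hab : a < b) (hT : SmoothOn a b T) (h1 : ∀ x ∈ Icc a b, ‖T x‖ = 1)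
    {x : ℝ} (hx : x ∈ Icc a b) : ⟪derivOn a b T x, T x⟫ = 0 := by
  have h2 := derivOn_eq hab hx ((hT.hasDerivWithinAt hx).inner ℝ (hT.hasDerivWithinAt hx))
  have h3 : derivOn a b (fun y => ⟪T y, T y⟫) x = 0 := by
    rw [derivOn_congr (g := fun _ => (1 : ℝ)) (fun y hy => inner_self_eq_one h1 hy) hx]
    exact derivOn_eq hab hx (hasDerivWithinAt_const _ _ _)
  rw [h3, real_inner_comm (derivOn a b T x) (T x)] at h2
  linarith

/-- Differentiate `⟪T', T⟫ = 0`. -/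
theorem inner_derivOn_derivOn_self (hab : a < b) (hT : SmoothOn a b T)
    (h1 : ∀ x ∈ Icc a b, ‖T x‖ = 1) {x : ℝ} (hx : x ∈ Icc a b) :
    ⟪derivOn a b (derivOn a b T) x, T x⟫ = -⟪derivOn a b T x, derivOn a b T x⟫ := by
  have h2 := derivOn_eq hab hx
    (((hT.derivOn hab).hasDerivWithinAt hx).inner ℝ (hT.hasDerivWithinAt hx))
  have h3 : derivOn a b (fun y => ⟪derivOn a b T y, T y⟫) x = 0 := by
    rw [derivOn_congr (g := fun _ => (0 : ℝ)) (fun y hy => inner_derivOn_self hab hT h1 hy) hx]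
    exact derivOn_eq hab hx (hasDerivWithinAt_const _ _ _)
  rw [h3] at h2
  linarith

end UnitField

variable {γ : ℝ → EuclideanSpace ℝ (Fin n)} {ϱ Λ : ℝ → ℝ}

theorem IsArcLengthCurve.unitTangent_eq (hγ : IsArcLengthCurve a b γ) :
    EqOn (unitTangent a b γ) (derivOn a b γ) (Icc a b) := fun x hx => by
  simp [unitTangent, arcDeriv, hγ.unit_speed x hx]

theorem IsArcLengthCurve.smoothOn_unitTangent (hγ : IsArcLengthCurve a b γ) (hab : a < b) :
    SmoothOn a b (unitTangent a b γ) :=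
  (hγ.smooth.derivOn hab).congr hγ.unitTangent_eq

theorem IsArcLengthCurve.norm_unitTangent (hγ : IsArcLengthCurve a b γ) :
    ∀ x ∈ Icc a b, ‖unitTangent a b γ x‖ = 1 := fun x hx => by
  rw [hγ.unitTangent_eq hx, hγ.unit_speed x hx]

/-- The integrand of the augmented energy in terms of the first two derivatives `v`, `w` of the
curve. -/
noncomputable def augmentedDensity (r l : ℝ) (v w : EuclideanSpace ℝ (Fin n)) : ℝ :=
  1 / 2 * (r * (⟪w, w⟫ / ‖v‖ ^ 3 - ⟪v, w⟫ ^ 2 / ‖v‖ ^ 5)) + 1 / 2 * (l * (⟪v, v⟫ - 1))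

theorem arcDeriv_unitTangent (hab : a < b) (hγ : SmoothOn a b γ)
    {x : ℝ} (hx : x ∈ Icc a b) (h0 : derivOn a b γ x ≠ 0) :
    arcDeriv a b γ (unitTangent a b γ) x = ‖derivOn a b γ x‖⁻¹ •
      (‖derivOn a b γ x‖⁻¹ • derivOn a b (derivOn a b γ) x
        - (⟪derivOn a b γ x, derivOn a b (derivOn a b γ) x⟫ / ‖derivOn a b γ x‖ ^ 3) •
          derivOn a b γ x) := by
  have hv := (hγ.derivOn hab).hasDerivWithinAt hx
  have h1 := ((hasDerivWithinAt_norm hv h0).inv (norm_ne_zero_iff.2 h0)).smul hv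
  have h2 := derivOn_eq hab hx h1
  have h3 : derivOn a b (unitTangent a b γ) x
      = derivOn a b (fun y => ‖derivOn a b γ y‖⁻¹ • derivOn a b γ y) x := rfl
  rw [arcDeriv, h3]
  congr 1
  refine h2.trans ?_
  rw [sub_eq_add_neg, ← neg_smul]
  congr 2
  field_simp

/-- In the square of the quotient rule formula the cross term `-2⟪v, w⟫²` and the square `+⟪v, w⟫²`
combine to a single negative term; the factor `‖v‖` from `ds` lowers the powers to `3` and `5`. -/
theorem inner_arcDeriv_unitTangent (hab : a < b) (hγ : SmoothOn a b γ) {x : ℝ}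
    (hx : x ∈ Icc a b) (h0 : derivOn a b γ x ≠ 0) :
    ⟪arcDeriv a b γ (unitTangent a b γ) x, arcDeriv a b γ (unitTangent a b γ) x⟫
        * ‖derivOn a b γ x‖ =
      ⟪derivOn a b (derivOn a b γ) x, derivOn a b (derivOn a b γ) x⟫ / ‖derivOn a b γ x‖ ^ 3
        - ⟪derivOn a b γ x, derivOn a b (derivOn a b γ) x⟫ ^ 2 / ‖derivOn a b γ x‖ ^ 5 := by
  rw [arcDeriv_unitTangent hab hγ hx h0]
  set v := derivOn a b γ x
  set w := derivOn a b (derivOn a b γ) x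
  have hs : ‖v‖ ≠ 0 := norm_ne_zero_iff.2 h0
  simp only [inner_smul_left, inner_smul_right, inner_sub_left, inner_sub_right,
    real_inner_comm v w, real_inner_self_eq_norm_sq v, conj_trivial]
  field_simp
  ring

theorem contDiffOn_augmentedDensity {X : Type*} [NormedAddCommGroup X] [NormedSpace ℝ X]
    {s : Set X} {r l : X → ℝ} {v w : X → EuclideanSpace ℝ (Fin n)} (hr : ContDiffOn ℝ ∞ r s) (hl : ContDiffOn ℝ ∞ l s)
    (hv : ContDiffOn ℝ ∞ v s) (hw : ContDiffOn ℝ ∞ w s) (h0 : ∀ p ∈ s, v p ≠ 0) :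
    ContDiffOn ℝ ∞ (fun p => augmentedDensity (r p) (l p) (v p) (w p)) s := by
  have hn : ContDiffOn ℝ ∞ (fun p => ‖v p‖) s := hv.norm ℝ h0
  have hvw := ContDiffOn.inner ℝ hv hw
  have hww := ContDiffOn.inner ℝ hw hw
  have hvv := ContDiffOn.inner ℝ hv hv
  have h3 : ∀ k : ℕ, ∀ p ∈ s, ‖v p‖ ^ k ≠ 0 := fun k p hp =>
    pow_ne_zero _ (norm_ne_zero_iff.2 (h0 p hp))
  unfold augmentedDensity
  exact (contDiffOn_const.mul (hr.mul ((hww.div (hn.pow 3) (h3 3)).sub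
    ((hvw.pow 2).div (hn.pow 5) (h3 5))))).add
      (contDiffOn_const.mul (hl.mul (hvv.sub contDiffOn_const)))

/-- Along regular curves the integrand is smooth in the first two derivatives, which prepares
differentiation under the integral sign. -/
theorem augmentedEnergy_eq (hab : a < b) (hϱ : SmoothOn a b ϱ) (hΛ : SmoothOn a b Λ)
    (hγ : SmoothOn a b γ) (h0 : ∀ x ∈ Icc a b, derivOn a b γ x ≠ 0) :
    augmentedEnergy a b ϱ Λ γ = ∫ x in a..b,
      augmentedDensity (ϱ x) (Λ x) (derivOn a b γ x) (derivOn a b (derivOn a b γ) x) := by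
  have h1 : ∀ x ∈ uIcc a b, ϱ x * ⟪arcDeriv a b γ (unitTangent a b γ) x,
      arcDeriv a b γ (unitTangent a b γ) x⟫ * ‖derivOn a b γ x‖
      = 2 * augmentedDensity (ϱ x) 0 (derivOn a b γ x) (derivOn a b (derivOn a b γ) x) := by
    intro x hx
    rw [uIcc_of_le hab.le] at hx
    rw [mul_assoc, inner_arcDeriv_unitTangent hab hγ hx (h0 x hx), augmentedDensity]
    ring
  have hv := hγ.derivOn hab
  have h2 : IntervalIntegrable (fun x => augmentedDensity (ϱ x) 0 (derivOn a b γ x)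
      (derivOn a b (derivOn a b γ) x)) volume a b :=
    (contDiffOn_augmentedDensity hϱ contDiffOn_const hv (hv.derivOn hab)
      h0).continuousOn.intervalIntegrable_of_Icc hab.le
  have h3 : IntervalIntegrable (fun x => 1 / 2 *
      (Λ x * (⟪derivOn a b γ x, derivOn a b γ x⟫ - 1))) volume a b :=
    (contDiffOn_const.mul (ContDiffOn.mul hΛ ((ContDiffOn.inner ℝ hv hv).sub
      contDiffOn_const))).continuousOn.intervalIntegrable_of_Icc hab.le
  rw [augmentedEnergy, bendingEnergy, intervalIntegral.integral_congr h1,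
    intervalIntegral.integral_const_mul, ← mul_assoc, ← intervalIntegral.integral_const_mul (1 / 2),
    show (1 / 2 * 2 : ℝ) = 1 by norm_num, one_mul, ← intervalIntegral.integral_add h2 h3]
  refine intervalIntegral.integral_congr fun x _ => ?_
  simp only [augmentedDensity]
  ring

/-- The derivative of the integrand of the augmented energy at an arc-length parametrized curve. -/
theorem hasDerivAt_augmentedDensity {v w : ℝ → EuclideanSpace ℝ (Fin n)} {v' w' : EuclideanSpace ℝ (Fin n)} {r l : ℝ}
    (hv : HasDerivAt v v' 0) (hw : HasDerivAt w w' 0) (h1 : ‖v 0‖ = 1) (h0 : ⟪v 0, w 0⟫ = 0) :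
    HasDerivAt (fun t => augmentedDensity r l (v t) (w t))
      (⟪r • w 0, w'⟫ + (l - 3 / 2 * r * ⟪w 0, w 0⟫) * ⟪v 0, v'⟫) 0 := by
  have hne : v 0 ≠ 0 := fun h => by simp [h] at h1
  have hn : HasDerivAt (fun t => ‖v t‖) (⟪v 0, v'⟫ / ‖v 0‖) 0 := by
    rw [← hasDerivWithinAt_univ] at hv ⊢
    exact hasDerivWithinAt_norm hv hne
  have hp : ∀ k : ℕ, ‖v 0‖ ^ k ≠ 0 := fun k => by simp [h1]
  -- The square `⟪v, w⟫²` has zero derivative at `t = 0` because `⟪v 0, w 0⟫ = 0`; the coefficient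
  -- `-3/2` comes from `‖v‖⁻³`.
  have key := ((((hw.inner ℝ hw).div (hn.pow 3) (hp 3)).sub
    (((hv.inner ℝ hw).pow 2).div (hn.pow 5) (hp 5))).const_mul r |>.const_mul (1 / 2)).add
      ((((hv.inner ℝ hv).sub_const 1).const_mul l).const_mul (1 / 2))
  unfold augmentedDensity
  refine key.congr_deriv ?_
  simp only [Pi.pow_apply, h1, h0, inner_smul_left, conj_trivial, real_inner_comm (w 0) w',
    real_inner_comm (v 0) v']
  ring

/-- The gradient of the augmented energy with respect to variations of the tangent field. -/
noncomputable def energyGradient (a b : ℝ) (ϱ Λ : ℝ → ℝ) (T : ℝ → EuclideanSpace ℝ (Fin n)) : ℝ → EuclideanSpace ℝ (Fin n) := fun x =>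
  (Λ x - 3 / 2 * ϱ x * ⟪derivOn a b T x, derivOn a b T x⟫) • T x
    - derivOn a b (fun y => ϱ y • derivOn a b T y) x

theorem smoothOn_energyGradient (hab : a < b) (hϱ : SmoothOn a b ϱ) (hΛ : SmoothOn a b Λ)
    {T : ℝ → EuclideanSpace ℝ (Fin n)} (hT : SmoothOn a b T) : SmoothOn a b (energyGradient a b ϱ Λ T) := by
  have h1 := hT.derivOn hab
  have h2 : SmoothOn a b fun y => ϱ y • derivOn a b T y := ContDiffOn.smul hϱ h1
  exact ((ContDiffOn.sub hΛ ((contDiffOn_const.mul hϱ).mul (ContDiffOn.inner ℝ h1 h1))).smul hT).sub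
    (h2.derivOn hab)

variable {ε : ℝ} {Γ : ℝ → ℝ → EuclideanSpace ℝ (Fin n)}

/-- Near the end point the curves coincide with `γ`. Hence the velocity of the tangent vanishes
there and integration by parts leaves no boundary term. -/
theorem IsVariation.derivOn_left (hΓ : IsVariation a b γ ε Γ) (hab : a < b) {t : ℝ}
    (ht : t ∈ Icc (-ε) ε) : derivOn a b (Γ t) a = derivOn a b γ a := by
  obtain ⟨δ, hδ, h⟩ := hΓ.compact_support
  refine EventuallyEq.derivWithin_eq ?_ (h t ht a ⟨le_rfl, hab.le⟩ (Or.inl (by linarith)))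
  filter_upwards [self_mem_nhdsWithin, nhdsWithin_le_nhds (Iio_mem_nhds (by linarith : a < a + δ))]
    with x hx hx'
  exact h t ht x hx (Or.inl (le_of_lt hx'))

theorem IsVariation.derivOn_right (hΓ : IsVariation a b γ ε Γ) (hab : a < b) {t : ℝ}
    (ht : t ∈ Icc (-ε) ε) : derivOn a b (Γ t) b = derivOn a b γ b := by
  obtain ⟨δ, hδ, h⟩ := hΓ.compact_support
  refine EventuallyEq.derivWithin_eq ?_ (h t ht b ⟨hab.le, le_rfl⟩ (Or.inr (by linarith)))
  filter_upwards [self_mem_nhdsWithin, nhdsWithin_le_nhds (Ioi_mem_nhds (by linarith : b - δ < b))]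
    with x hx hx'
  exact h t ht x hx (Or.inr (le_of_lt hx'))

/-- The first variation formula for the augmented energy. -/
theorem IsVariation.hasDerivAt_augmentedEnergy (hΓ : IsVariation a b γ ε Γ) (hab : a < b)
    (hγ : IsArcLengthCurve a b γ) (hϱ : SmoothOn a b ϱ) (hΛ : SmoothOn a b Λ) {D : ℝ → EuclideanSpace ℝ (Fin n)}
    (hD : ∀ x ∈ Icc a b, HasDerivAt (fun t => derivOn a b (Γ t) x) (D x) 0) :
    HasDerivAt (fun t => augmentedEnergy a b ϱ Λ (Γ t))
      (∫ x in a..b, ⟪energyGradient a b ϱ Λ (derivOn a b γ) x, D x⟫) 0 := by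
  have hε := hΓ.eps_pos
  have h0ε : (0 : ℝ) ∈ Icc (-ε) ε := by simp [hε.le]
  have hv := contDiffOn_derivOn hε hab hΓ.smooth
  have hw := contDiffOn_derivOn (f := fun t => derivOn a b (Γ t)) hε hab hv
  have hv0 : ∀ x ∈ Icc a b, derivOn a b (Γ 0) x = derivOn a b γ x := fun x hx =>
    derivOn_congr hΓ.at_zero hx
  have hw0 : ∀ x ∈ Icc a b, derivOn a b (derivOn a b (Γ 0)) x = derivOn a b (derivOn a b γ) x :=
    fun x hx => derivOn_congr hv0 hx
  have hDs : SmoothOn a b D := smoothOn_velocity (f := fun t => derivOn a b (Γ t)) hε hab hv hD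
  have hD' : ∀ x ∈ Icc a b, HasDerivAt (fun t => derivOn a b (derivOn a b (Γ t)) x)
      (derivOn a b D x) 0 := fun x hx =>
    hasDerivAt_derivOn (f := fun t => derivOn a b (Γ t)) hε hab hv hD hx
  have hend : ∀ x ∈ Icc a b, (∀ t ∈ Icc (-ε) ε, derivOn a b (Γ t) x = derivOn a b γ x) →
      D x = 0 := fun x hx h => by
    refine (hD x hx).unique ((hasDerivAt_const 0 (derivOn a b γ x)).congr_of_eventuallyEq ?_)
    filter_upwards [Icc_mem_nhds (by linarith : -ε < 0) hε] with t ht using h t ht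
  have hDa : D a = 0 := hend a ⟨le_rfl, hab.le⟩ fun t ht => hΓ.derivOn_left hab ht
  have hDb : D b = 0 := hend b ⟨hab.le, le_rfl⟩ fun t ht => hΓ.derivOn_right hab ht
  -- For small `t`, uniform continuity keeps the derivative of `Γ t` at distance less than `1` from
  -- the unit vector `γ'`, so the curves stay regular.
  obtain ⟨η, hη, hηε, hne⟩ : ∃ η > 0, η ≤ ε ∧
      ∀ t ∈ Icc (-η) η, ∀ x ∈ Icc a b, derivOn a b (Γ t) x ≠ 0 := by
    have huc := (isCompact_Icc.prod isCompact_Icc).uniformContinuousOn_of_continuous hv.continuousOn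
    obtain ⟨δ, hδ, h⟩ := Metric.uniformContinuousOn_iff.1 huc 1 one_pos
    refine ⟨min ε (δ / 2), lt_min hε (by linarith), min_le_left _ _, fun t ht x hx h0 => ?_⟩
    have ht1 : t ∈ Icc (-ε) ε := Icc_subset_Icc (neg_le_neg (min_le_left _ _)) (min_le_left _ _) ht
    have ht2 : |t| < δ := by
      have := abs_le.2 ht
      have := min_le_right ε (δ / 2)
      linarith
    have := h (t, x) ⟨ht1, hx⟩ (0, x) ⟨h0ε, hx⟩ (by simpa [Prod.dist_eq, hδ] using ht2)
    simp only [h0, hv0 x hx, dist_zero_left, hγ.unit_speed x hx, lt_irrefl] at this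
  have hsub : Icc (-η) η ×ˢ Icc a b ⊆ Icc (-ε) ε ×ˢ Icc a b :=
    prod_mono (Icc_subset_Icc (by linarith) hηε) le_rfl
  have hdens : ContDiffOn ℝ ∞ (fun p : ℝ × ℝ => augmentedDensity (ϱ p.2) (Λ p.2)
      (derivOn a b (Γ p.1) p.2) (derivOn a b (derivOn a b (Γ p.1)) p.2))
      (Icc (-η) η ×ˢ Icc a b) :=
    contDiffOn_augmentedDensity (hϱ.comp contDiffOn_snd fun p hp => hp.2)
      (hΛ.comp contDiffOn_snd fun p hp => hp.2) (hv.mono hsub) (hw.mono hsub)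
      fun p hp => hne p.1 hp.1 p.2 hp.2
  have hT := hγ.smooth.derivOn hab
  have hI := hasDerivAt_integral_of_contDiffOn (f := fun t x => augmentedDensity (ϱ x) (Λ x)
      (derivOn a b (Γ t) x) (derivOn a b (derivOn a b (Γ t)) x)) hη hab hdens
    (g := fun x => ⟪ϱ x • derivOn a b (derivOn a b γ) x, derivOn a b D x⟫
      + (Λ x - 3 / 2 * ϱ x * ⟪derivOn a b (derivOn a b γ) x, derivOn a b (derivOn a b γ) x⟫)
        * ⟪derivOn a b γ x, D x⟫) (fun x hx => by
      have := hasDerivAt_augmentedDensity (r := ϱ x) (l := Λ x) (hD x hx) (hD' x hx)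
        (by rw [hv0 x hx, hγ.unit_speed x hx])
        (by rw [hv0 x hx, hw0 x hx, real_inner_comm,
          inner_derivOn_self hab hT hγ.unit_speed hx])
      simpa only [hv0 x hx, hw0 x hx] using this)
  have hP : SmoothOn a b fun x => ϱ x • derivOn a b (derivOn a b γ) x :=
    ContDiffOn.smul hϱ (hT.derivOn hab)
  have hL : SmoothOn a b fun x => (Λ x - 3 / 2 * ϱ x *
      ⟪derivOn a b (derivOn a b γ) x, derivOn a b (derivOn a b γ) x⟫) * ⟪derivOn a b γ x, D x⟫ :=
    (ContDiffOn.sub hΛ ((contDiffOn_const.mul hϱ).mul (ContDiffOn.inner ℝ (hT.derivOn hab)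
      (hT.derivOn hab)))).mul (ContDiffOn.inner ℝ hT hDs)
  have hint : ∀ {f : ℝ → ℝ}, SmoothOn a b f → IntervalIntegrable f volume a b := fun hf =>
    (ContDiffOn.continuousOn hf).intervalIntegrable_of_Icc hab.le
  -- Integration by parts moves the derivative from `D'` onto `ϱT'`.
  have hval : ∫ x in a..b, ⟪energyGradient a b ϱ Λ (derivOn a b γ) x, D x⟫
      = ∫ x in a..b, (⟪ϱ x • derivOn a b (derivOn a b γ) x, derivOn a b D x⟫
      + (Λ x - 3 / 2 * ϱ x * ⟪derivOn a b (derivOn a b γ) x, derivOn a b (derivOn a b γ) x⟫)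
        * ⟪derivOn a b γ x, D x⟫) := by
    rw [intervalIntegral.integral_add (hint (ContDiffOn.inner ℝ hP (hDs.derivOn hab))) (hint hL),
      integral_inner_derivOn hab hP hDs hDa hDb, add_comm, ← sub_eq_add_neg,
      ← intervalIntegral.integral_sub (hint hL)
        (hint (ContDiffOn.inner ℝ (hP.derivOn hab) hDs))]
    refine intervalIntegral.integral_congr fun x _ => ?_
    simp only [energyGradient, inner_sub_left, inner_smul_left, conj_trivial]
  rw [hval]
  refine hI.congr_of_eventuallyEq ?_
  filter_upwards [Icc_mem_nhds (by linarith : -η < 0) hη] with t ht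
  exact augmentedEnergy_eq hab hϱ hΛ
    (smoothOn_slice hΓ.smooth (Icc_subset_Icc (by linarith) hηε ht)) (hne t ht)

end FirstVariation

/-! ### Pointwise multipliers -/

section Multiplier

variable {n : ℕ} {a b : ℝ} {γ : ℝ → EuclideanSpace ℝ (Fin n)} {ϱ Λ : ℝ → ℝ}

theorem derivOn_smul_derivOn (hab : a < b) (hϱ : SmoothOn a b ϱ)
    {T : ℝ → EuclideanSpace ℝ (Fin n)} (hT : SmoothOn a b T) {x : ℝ} (hx : x ∈ Icc a b) :
    derivOn a b (fun y => ϱ y • derivOn a b T y) x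
      = ϱ x • derivOn a b (derivOn a b T) x + derivOn a b ϱ x • derivOn a b T x :=
  derivOn_eq hab hx ((hϱ.hasDerivWithinAt hx).smul ((hT.derivOn hab).hasDerivWithinAt hx))

/-- The gradient of the augmented energy is the constant `-A` if and only if the tangent field
solves the pendulum equation and the multiplier has the corresponding form. -/
theorem energyGradient_eq_neg_iff (hab : a < b) (hϱ : SmoothOn a b ϱ)
    {T : ℝ → EuclideanSpace ℝ (Fin n)} (hT : SmoothOn a b T) (h1 : ∀ x ∈ Icc a b, ‖T x‖ = 1)
    {A : EuclideanSpace ℝ (Fin n)} :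
    (∀ x ∈ Icc a b, energyGradient a b ϱ Λ T x = -A) ↔ PendulumEq a b ϱ T A ∧
      ∀ x ∈ Icc a b, Λ x = 1 / 2 * ϱ x * ⟪derivOn a b T x, derivOn a b T x⟫ - ⟪A, T x⟫ := by
  rw [PendulumEq, ← forall₂_and]
  refine forall₂_congr fun x hx => ?_
  have hT1 := inner_self_eq_one h1 hx
  have hT2 := inner_derivOn_self hab hT h1 hx
  have hT3 := inner_derivOn_derivOn_self hab hT h1 hx
  rw [energyGradient, derivOn_smul_derivOn hab hϱ hT hx, hT3]
  set k := ⟪derivOn a b T x, derivOn a b T x⟫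
  constructor
  · intro h
    -- The tangential component: `⟪T'', T⟫ = -|T'|²` turns the coefficient `-3/2` into `-1/2`.
    -- Inserting the resulting `Λ` leaves the normal component.
    have h2 := congrArg (fun v => ⟪v, T x⟫) h
    simp only [inner_sub_left, inner_add_left, inner_smul_left, inner_neg_left, conj_trivial, hT1,
      hT2, hT3] at h2
    have h3 : Λ x = 1 / 2 * ϱ x * k - ⟪A, T x⟫ := by linarith
    refine ⟨?_, h3⟩
    rw [h3] at h
    rw [← sub_eq_zero] at h ⊢
    rw [← neg_eq_zero, ← h]
    module
  · rintro ⟨h2, h3⟩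
    rw [h3, ← sub_eq_zero]
    rw [← sub_eq_zero] at h2
    rw [← neg_eq_zero, ← h2]
    module

/-- Pairing with all constant vectors `e` reduces the vector-valued fundamental lemma to test fields
`φ • e`. -/
theorem inner_integral_smul (hab : a < b) {φ : ℝ → ℝ} {h : ℝ → EuclideanSpace ℝ (Fin n)}
    (hφ : Continuous φ) (hh : ContinuousOn h (Icc a b)) (e : EuclideanSpace ℝ (Fin n)) :
    ⟪e, ∫ x in a..b, φ x • h x⟫ = ∫ x in a..b, ⟪h x, φ x • e⟫ := by
  have := (innerSL ℝ e).intervalIntegral_comp_comm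
    ((hφ.continuousOn.smul hh).intervalIntegrable_of_Icc (μ := volume) hab.le)
  refine this.symm.trans (intervalIntegral.integral_congr fun x _ => ?_)
  simp only [innerSL_apply_apply, Pi.smul_apply', inner_smul_right, real_inner_comm]

theorem eq_zero_endpoints_of_tsupport_subset {F : Type*} [NormedAddCommGroup F] [NormedSpace ℝ F]
    {φ : ℝ → F} (hs : tsupport φ ⊆ Ioo a b) : φ a = 0 ∧ φ b = 0 :=
  ⟨image_eq_zero_of_notMem_tsupport fun h => (hs h).1.false,
    image_eq_zero_of_notMem_tsupport fun h => (hs h).2.false⟩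

/-- The lemma of du Bois-Reymond. -/
theorem eq_left_of_forall_integral_inner_derivOn_eq_zero (hab : a < b)
    {Q : ℝ → EuclideanSpace ℝ (Fin n)} (hQ : SmoothOn a b Q)
    (H : ∀ η : ℝ → EuclideanSpace ℝ (Fin n), ContDiff ℝ ∞ η → HasCompactSupport η →
      tsupport η ⊆ Ioo a b → ∫ x in a..b, ⟪Q x, derivOn a b η x⟫ = 0) :
    ∀ x ∈ Icc a b, Q x = Q a := by
  have hQ' := hQ.derivOn hab
  refine hQ.eq_left_of_derivOn_eq_zero
    (eqOn_zero_of_forall_integral_smul_eq_zero hab (ContDiffOn.continuousOn hQ') ?_)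
  intro φ hφ hc hs
  refine ext_inner_left ℝ fun e => ?_
  have hη : ContDiff ℝ ∞ fun x => φ x • e := hφ.smul contDiff_const
  have hsub : tsupport (fun x => φ x • e) ⊆ tsupport φ :=
    closure_mono fun x hx h => hx (by simp [h])
  obtain ⟨h1, h2⟩ := eq_zero_endpoints_of_tsupport_subset (hsub.trans hs)
  rw [inner_zero_right, inner_integral_smul hab hφ.continuous (ContDiffOn.continuousOn hQ') e,
    ← neg_eq_zero, ← integral_inner_derivOn hab hQ hη.contDiffOn h1 h2]
  exact H _ hη (hc.mono' ((subset_tsupport _).trans hsub)) (hsub.trans hs)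

/-- Multipliers are tested without the arc-length constraint, so affine variations provide enough
test fields. -/
theorem isVariation_add_smul (hγ : SmoothOn a b γ)
    {η : ℝ → EuclideanSpace ℝ (Fin n)} (hη : ContDiff ℝ ∞ η) (hc : HasCompactSupport η)
    (hs : tsupport η ⊆ Ioo a b) : IsVariation a b γ 1 fun t x => γ x + t • η x where
  eps_pos := one_pos
  smooth := (hγ.comp contDiffOn_snd fun p hp => hp.2).add
    (contDiffOn_fst.smul (hη.comp contDiff_snd).contDiffOn)
  at_zero x _ := by simp
  compact_support := by
    obtain ⟨δ, hδ, h⟩ := exists_margin hc hs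
    exact ⟨δ, hδ, fun t _ x _ hx => by simp [image_eq_zero_of_notMem_tsupport (h x hx)]⟩

/-- The velocity of the tangent is `V'` for the velocity `V` of the curves. Forward, this is du
Bois-Reymond; backward, integrate by parts against a constant gradient. -/
theorem isMultiplier_iff_energyGradient (hab : a < b) (hγ : IsArcLengthCurve a b γ)
    (hϱ : SmoothOn a b ϱ) (hΛ : SmoothOn a b Λ) :
    IsMultiplier a b ϱ γ Λ ↔
      ∃ A, ∀ x ∈ Icc a b, energyGradient a b ϱ Λ (derivOn a b γ) x = -A := by
  have hT := hγ.smooth.derivOn hab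
  constructor
  · intro h
    refine ⟨-energyGradient a b ϱ Λ (derivOn a b γ) a, fun x hx => ?_⟩
    rw [neg_neg]
    refine eq_left_of_forall_integral_inner_derivOn_eq_zero hab
      (smoothOn_energyGradient hab hϱ hΛ hT) (fun η hη hc hs => ?_) x hx
    have hΓ := isVariation_add_smul hγ.smooth hη hc hs
    refine (hΓ.hasDerivAt_augmentedEnergy hab hγ hϱ hΛ fun x hx => ?_).unique (h.critical 1 _ hΓ)
    refine hasDerivAt_derivOn (f := fun t x => γ x + t • η x) hΓ.eps_pos hab hΓ.smooth
      (fun y _ => ?_) hx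
    simpa using ((hasDerivAt_id (0 : ℝ)).smul_const (η y)).const_add (γ y)
  · rintro ⟨A, hA⟩
    refine ⟨hΛ, fun ε Γ hΓ => ?_⟩
    have hε := hΓ.eps_pos
    have h0 : (0 : ℝ) ∈ Ioo (-ε) ε := by simp [hε]
    set V : ℝ → EuclideanSpace ℝ (Fin n) := fun x =>
      fderivWithin ℝ (fun p : ℝ × ℝ => Γ p.1 p.2) (Icc (-ε) ε ×ˢ Icc a b) (0, x) (1, 0) with hV
    have hV' : ∀ x ∈ Icc a b, HasDerivAt (fun t => Γ t x) (V x) 0 := fun x hx =>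
      hasDerivAt_fst hΓ.smooth h0 hx
    have hVs := smoothOn_velocity hε hab hΓ.smooth hV'
    have hend : ∀ x ∈ Icc a b, (∀ t ∈ Icc (-ε) ε, Γ t x = γ x) → V x = 0 := fun x hx h => by
      refine (hV' x hx).unique ((hasDerivAt_const 0 (γ x)).congr_of_eventuallyEq ?_)
      filter_upwards [Icc_mem_nhds (by linarith : -ε < 0) hε] with t ht using h t ht
    obtain ⟨δ, hδ, hsupp⟩ := hΓ.compact_support
    have hVa : V a = 0 := hend a ⟨le_rfl, hab.le⟩ fun t ht =>
      hsupp t ht a ⟨le_rfl, hab.le⟩ (Or.inl (by linarith))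
    have hVb : V b = 0 := hend b ⟨hab.le, le_rfl⟩ fun t ht =>
      hsupp t ht b ⟨hab.le, le_rfl⟩ (Or.inr (by linarith))
    have key := hΓ.hasDerivAt_augmentedEnergy hab hγ hϱ hΛ fun x hx =>
      hasDerivAt_derivOn hε hab hΓ.smooth hV' hx
    have hzero : ∫ x in a..b, ⟪energyGradient a b ϱ Λ (derivOn a b γ) x, derivOn a b V x⟫ = 0 := by
      rw [integral_inner_derivOn hab (smoothOn_energyGradient hab hϱ hΛ hT) hVs hVa hVb,
        neg_eq_zero]
      refine (intervalIntegral.integral_congr fun x hx => ?_).trans intervalIntegral.integral_zero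
      rw [uIcc_of_le hab.le] at hx
      have : derivOn a b (energyGradient a b ϱ Λ (derivOn a b γ)) x = 0 := by
        rw [derivOn_congr (g := fun _ => -A) hA hx]
        exact derivOn_eq hab hx (hasDerivWithinAt_const _ _ _)
      simp [this]
    rwa [hzero] at key

theorem isMultiplier_iff (hab : a < b) (hγ : IsArcLengthCurve a b γ)
    (hϱ : SmoothOn a b ϱ) (hΛ : SmoothOn a b Λ) :
    IsMultiplier a b ϱ γ Λ ↔ ∃ A, PendulumEq a b ϱ (unitTangent a b γ) A ∧
      ∀ x ∈ Icc a b, Λ x =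
        1 / 2 * ϱ x * ⟪derivOn a b (unitTangent a b γ) x, derivOn a b (unitTangent a b γ) x⟫
          - ⟪A, unitTangent a b γ x⟫ := by
  rw [isMultiplier_iff_energyGradient hab hγ hϱ hΛ]
  refine exists_congr fun A => ?_
  rw [← energyGradient_eq_neg_iff hab hϱ (hγ.smoothOn_unitTangent hab) hγ.norm_unitTangent]
  refine forall₂_congr fun x hx => ?_
  have h1 : ∀ y ∈ Icc a b, derivOn a b (unitTangent a b γ) y = derivOn a b (derivOn a b γ) y :=
    fun y hy => derivOn_congr hγ.unitTangent_eq hy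
  rw [energyGradient, energyGradient, h1 x hx, hγ.unitTangent_eq hx]
  rw [derivOn_congr (f := fun y => ϱ y • derivOn a b (unitTangent a b γ) y)
    (g := fun y => ϱ y • derivOn a b (derivOn a b γ) y) (fun y hy => by simp only [h1 y hy]) hx]

/-- The constraint term is zero at unit speed; thus any multiplier certifies elasticity. -/
theorem bendingEnergy_eq_augmentedEnergy {c : ℝ → EuclideanSpace ℝ (Fin n)} (hab : a < b)
    (h : ∀ x ∈ Icc a b, ‖derivOn a b c x‖ = 1) :
    bendingEnergy a b ϱ c = augmentedEnergy a b ϱ Λ c := by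
  have : ∫ x in a..b, Λ x * (⟪derivOn a b c x, derivOn a b c x⟫ - 1) = ∫ _ in a..b, (0 : ℝ) := by
    refine intervalIntegral.integral_congr fun x hx => ?_
    rw [uIcc_of_le hab.le] at hx
    simp only [inner_self_eq_one h hx, sub_self, mul_zero]
  rw [augmentedEnergy, this]
  simp

/-- Solutions of the pendulum equation are elastic. -/
theorem PendulumEq.isElastic (hab : a < b) (hγ : IsArcLengthCurve a b γ) (hϱ : SmoothOn a b ϱ)
    {A : EuclideanSpace ℝ (Fin n)} (hA : PendulumEq a b ϱ (unitTangent a b γ) A) :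
    IsElastic a b ϱ γ := by
  intro ε Γ hΓ h1
  have hT := hγ.smoothOn_unitTangent hab
  have hT' := hT.derivOn hab
  have hΛ : SmoothOn a b fun x =>
      1 / 2 * ϱ x * ⟪derivOn a b (unitTangent a b γ) x, derivOn a b (unitTangent a b γ) x⟫
        - ⟪A, unitTangent a b γ x⟫ :=
    ((contDiffOn_const.mul hϱ).mul (ContDiffOn.inner ℝ hT' hT')).sub
      (ContDiffOn.inner ℝ contDiffOn_const hT)
  have hM := (isMultiplier_iff hab hγ hϱ hΛ).2 ⟨A, hA, fun x _ => rfl⟩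
  refine (hM.critical ε Γ hΓ).congr_of_eventuallyEq ?_
  filter_upwards [Icc_mem_nhds (by linarith [hΓ.eps_pos] : -ε < 0) hΓ.eps_pos] with t ht
  exact bendingEnergy_eq_augmentedEnergy hab (h1 t ht)

/-- For constant stiffness the multipliers are constant. -/
theorem IsMultiplier.eq_const (hab : a < b) (hγ : IsArcLengthCurve a b γ)
    (hϱ : SmoothOn a b ϱ) {c : ℝ} (hc : ∀ x ∈ Icc a b, ϱ x = c)
    (hΛ : IsMultiplier a b ϱ γ Λ) : ∃ l, ∀ x ∈ Icc a b, Λ x = l := by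
  obtain ⟨A, hA, hΛA⟩ := (isMultiplier_iff hab hγ hϱ hΛ.smooth).1 hΛ
  refine ⟨Λ a, hΛ.smooth.eq_left_of_derivOn_eq_zero fun x hx => ?_⟩
  set T := unitTangent a b γ
  have hT : SmoothOn a b T := hγ.smoothOn_unitTangent hab
  have hT' := hT.derivOn hab
  have h1 := inner_derivOn_self hab hT hγ.norm_unitTangent hx
  have hϱ' : derivOn a b ϱ x = 0 := by
    rw [derivOn_congr (g := fun _ => c) hc hx]
    exact derivOn_eq hab hx (hasDerivWithinAt_const _ _ _)
  have h2 : HasDerivWithinAt (fun y => 1 / 2 * c * ⟪derivOn a b T y, derivOn a b T y⟫ - ⟪A, T y⟫)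
      _ (Icc a b) x :=
    (((hT'.hasDerivWithinAt hx).inner ℝ (hT'.hasDerivWithinAt hx)).const_mul (1 / 2 * c)).sub
      ((hasDerivWithinAt_const x (Icc a b) A).inner ℝ (hT.hasDerivWithinAt hx))
  rw [derivOn_congr (g := fun y => 1 / 2 * c * ⟪derivOn a b T y, derivOn a b T y⟫ - ⟪A, T y⟫)
    (fun y hy => by rw [hΛA y hy, hc y hy]) hx, derivOn_eq hab hx h2]
  -- Pairing with `T' ⟂ T` gives `c⟪T'', T'⟫ = ⟪A, T'⟫`, which says that `Λ'` vanishes.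
  have h3 := congrArg (fun v => ⟪v, derivOn a b T x⟫) (hA x hx)
  simp only [inner_sub_left, inner_add_left, inner_smul_left, conj_trivial, hϱ', hc x hx,
    real_inner_comm (derivOn a b T x) (T x), h1] at h3
  rw [real_inner_comm (derivOn a b (derivOn a b T) x) (derivOn a b T x), inner_zero_left]
  linarith

end Multiplier

/-! ### Implicit functions and primitives with parameters -/

section Implicit

/-- A smooth one-parameter family of solutions of an equation whose partial derivative with respect
to the unknown is the identity and whose derivative with respect to the parameter vanishes. -/
theorem exists_smooth_solution {E : Type*} [NormedAddCommGroup E] [NormedSpace ℝ E]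
    [CompleteSpace E] {f : ℝ × E → E} (hf : ContDiff ℝ ∞ f) (h0 : f 0 = 0)
    (hf' : fderiv ℝ f 0 = ContinuousLinearMap.snd ℝ ℝ E) :
    ∃ ε > 0, ∃ s : ℝ → E, ContDiffOn ℝ ∞ s (Icc (-ε) ε) ∧ s 0 = 0 ∧ HasDerivAt s 0 0 ∧
      ∀ t ∈ Icc (-ε) ε, f (t, s t) = 0 := by
  have hne : (∞ : WithTop ℕ∞) ≠ 0 := by simp
  have hinr : fderiv ℝ f 0 ∘L .inr ℝ ℝ E = ContinuousLinearEquiv.refl ℝ E := by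
    rw [hf']; ext x; simp
  have hinv : (fderiv ℝ f 0 ∘L .inr ℝ ℝ E).IsInvertible := ⟨_, hinr.symm⟩
  have hcd : ContDiffAt ℝ ∞ f 0 := hf.contDiffAt
  set s := hcd.implicitFunction hne hinv with hs
  have hs0 : s 0 = 0 := hcd.implicitFunction_apply_self hne hinv
  have hsd : HasDerivAt s 0 0 := by
    have h1 := (hcd.hasStrictFDerivAt_implicitFunction hne hinv).hasFDerivAt.hasDerivAt
    have h2 : fderiv ℝ f 0 ∘L .inl ℝ ℝ E = 0 := by rw [hf']; ext; simp
    rw [h2] at h1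
    simpa using h1
  have hscd : ContDiffAt ℝ 1 s 0 :=
    (hcd.contDiffAt_implicitFunction hne hinv).of_le (by simp)
  have hcont : ∀ᶠ t in 𝓝 (0 : ℝ), ContinuousAt s t :=
    (hscd.eventually (by simp)).mono fun t ht => ht.continuousAt
  have hsol : ∀ᶠ t in 𝓝 (0 : ℝ), f (t, s t) = 0 :=
    (hcd.eventually_apply_implicitFunction hne hinv).mono fun t ht => by rw [ht, h0]
  have hpair : ∀ t, ContinuousAt s t → ContinuousAt (fun r => (r, s r)) t := fun t ht =>
    continuousAt_id.prodMk ht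
  have hinv' : ∀ᶠ t in 𝓝 (0 : ℝ), (fderiv ℝ f (t, s t) ∘L .inr ℝ ℝ E).IsInvertible := by
    have hc : ContinuousAt (fun t => fderiv ℝ f (t, s t) ∘L .inr ℝ ℝ E) 0 :=
      (((hf.continuous_fderiv hne).continuousAt.comp (hpair 0 hsd.continuousAt)).clm_comp
        continuousAt_const)
    have h00 : fderiv ℝ f (0, s 0) ∘L .inr ℝ ℝ E = ContinuousLinearEquiv.refl ℝ E := by
      rw [hs0]; exact hinr
    have := hc.eventually_mem (by
      rw [h00]; exact ContinuousLinearEquiv.nhds (ContinuousLinearEquiv.refl ℝ E))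
    exact this
  -- Smoothness at `0` alone allows neighbourhoods shrinking with the order of differentiability.
  -- For one interval valid for all orders, `s` is compared near each `t` with the implicit function
  -- based at `(t, s t)`.
  have hsmooth : ∀ᶠ t in 𝓝 (0 : ℝ), ContDiffAt ℝ ∞ s t := by
    filter_upwards [hcont, hsol.eventually_nhds, hinv'] with t ht1 ht2 ht3
    have hcd' : ContDiffAt ℝ ∞ f (t, s t) := hf.contDiffAt
    refine (hcd'.contDiffAt_implicitFunction hne ht3).congr_of_eventuallyEq ?_
    filter_upwards [ht2,
      (hpair t ht1).eventually (hcd'.eventually_apply_eq_iff_implicitFunction hne ht3)] with r hr1 hr2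
    exact (hr2.1 (by rw [hr1, ht2.self_of_nhds])).symm
  obtain ⟨ε, hε, h⟩ := Metric.eventually_nhds_iff.1 (hsmooth.and hsol)
  have hd : ∀ t ∈ Icc (-(ε / 2)) (ε / 2), dist t 0 < ε := fun t ht => by
    rw [Real.dist_eq, sub_zero]
    linarith [abs_le.2 ht]
  exact ⟨ε / 2, by linarith, s, fun t ht => (h (hd t ht)).1.contDiffWithinAt, hs0, hsd,
    fun t ht => (h (hd t ht)).2⟩

/-- The primitive of a smooth family of compactly supported functions is jointly smooth. -/
theorem contDiff_integral_of_compact_support {P F : Type*} [NormedAddCommGroup P] [NormedSpace ℝ P]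
    [NormedAddCommGroup F] [NormedSpace ℝ F] [CompleteSpace F] {g : P → ℝ → F}
    (hg : ContDiff ℝ ∞ fun q : P × ℝ => g q.1 q.2) {K : Set ℝ} (hK : IsCompact K)
    (h0 : ∀ p, ∀ x ∉ K, g p x = 0) (a : ℝ) :
    ContDiff ℝ ∞ fun q : P × ℝ => ∫ y in a..q.2, g q.1 y := by
  -- Convolution with the Heaviside function is integration from `-∞`, so smoothness of parametric
  -- convolutions applies.
  set H : ℝ → ℝ := (Ici (0 : ℝ)).indicator fun _ => 1
  have hH : LocallyIntegrable H volume :=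
    (locallyIntegrable_const (1 : ℝ)).indicator measurableSet_Ici
  have hconv : ContDiff ℝ ∞ fun q : P × ℝ =>
      convolution H (g q.1) (ContinuousLinearMap.lsmul ℝ ℝ) volume q.2 := by
    rw [← contDiffOn_univ, ← univ_prod_univ]
    exact contDiffOn_convolution_right_with_param (n := ⊤) (ContinuousLinearMap.lsmul ℝ ℝ)
      isOpen_univ hK (fun p x _ hx => h0 p x hx) hH hg.contDiffOn
  have hint : ∀ p, Integrable (g p) := fun p =>
    (hg.continuous.comp (Continuous.prodMk_right p)).integrable_of_hasCompactSupport
      (HasCompactSupport.intro hK (h0 p))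
  have hval : ∀ p x, convolution H (g p) (ContinuousLinearMap.lsmul ℝ ℝ) volume x
      = ∫ y in Iic x, g p y := by
    intro p x
    rw [convolution_def, ← integral_indicator measurableSet_Iic,
      ← integral_sub_left_eq_self _ volume x]
    congr 1
    ext t
    simp [H, indicator]
  have heq : (fun q : P × ℝ => ∫ y in a..q.2, g q.1 y) = fun q : P × ℝ =>
      convolution H (g q.1) (ContinuousLinearMap.lsmul ℝ ℝ) volume q.2
        - convolution H (g q.1) (ContinuousLinearMap.lsmul ℝ ℝ) volume a := by
    ext q
    rw [hval, hval, intervalIntegral.integral_Iic_sub_Iic (hint _).integrableOn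
      (hint _).integrableOn]
  rw [heq]
  exact hconv.sub (hconv.comp (contDiff_fst.prodMk contDiff_const))

end Implicit

/-! ### Normal fields and unit speed variations -/

section NormalFields

variable {n : ℕ} {a b : ℝ}

/-- The smooth fields normal to `T` with compact support in the interior of `[a, b]`. -/
def normalFields (a b : ℝ) (T : ℝ → EuclideanSpace ℝ (Fin n)) :
    Submodule ℝ (ℝ → EuclideanSpace ℝ (Fin n)) where
  carrier := {V | ContDiff ℝ ∞ V ∧ HasCompactSupport V ∧ tsupport V ⊆ Ioo a b ∧
    ∀ x ∈ Icc a b, ⟪V x, T x⟫ = 0}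
  zero_mem' := ⟨contDiff_const, HasCompactSupport.zero, by simp [tsupport], by simp⟩
  add_mem' := by
    rintro V W ⟨h1, h2, h3, h4⟩ ⟨k1, k2, k3, k4⟩
    refine ⟨h1.add k1, h2.add k2, (tsupport_add V W).trans (union_subset h3 k3), fun x hx => ?_⟩
    rw [Pi.add_apply, inner_add_left, h4 x hx, k4 x hx, add_zero]
  smul_mem' := by
    rintro c V ⟨h1, h2, h3, h4⟩
    have hsub : tsupport (c • V) ⊆ tsupport V :=
      closure_mono (Function.support_const_smul_subset c V)
    refine ⟨h1.const_smul c, h2.mono' ((subset_tsupport _).trans hsub), hsub.trans h3,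
      fun x hx => ?_⟩
    rw [Pi.smul_apply, inner_smul_left, h4 x hx, mul_zero]

variable {T : ℝ → EuclideanSpace ℝ (Fin n)}

/-- Project `φ • e` to the complement of `T`. For smoothness on the line, `T` is replaced by a
global field agreeing with it on the support of `φ`. -/
theorem exists_normalField (hab : a < b) (hT : SmoothOn a b T) (h1 : ∀ x ∈ Icc a b, ‖T x‖ = 1)
    {φ : ℝ → ℝ} (hφ : ContDiff ℝ ∞ φ) (hc : HasCompactSupport φ) (hs : tsupport φ ⊆ Ioo a b)
    (e : EuclideanSpace ℝ (Fin n)) :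
    ∃ V ∈ normalFields a b T, ∀ x, V x = φ x • (e - ⟪e, T x⟫ • T x) := by
  obtain ⟨S, hS, hST⟩ := hT.exists_contDiff_eqOn hab hc hs
  have hV : ∀ x, φ x • (e - ⟪e, S x⟫ • S x) = φ x • (e - ⟪e, T x⟫ • T x) := fun x => by
    by_cases hx : x ∈ tsupport φ
    · rw [hST hx]
    · rw [image_eq_zero_of_notMem_tsupport hx, zero_smul, zero_smul]
  have hsub : tsupport (fun x => φ x • (e - ⟪e, S x⟫ • S x)) ⊆ tsupport φ :=
    closure_mono fun x hx h => hx (by simp [h])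
  refine ⟨fun x => φ x • (e - ⟪e, S x⟫ • S x), ⟨?_, ?_, hsub.trans hs, fun x hx => ?_⟩, hV⟩
  · exact hφ.smul (contDiff_const.sub ((contDiff_const.inner ℝ hS).smul hS))
  · exact hc.mono' ((subset_tsupport _).trans hsub)
  · change ⟪φ x • (e - ⟪e, S x⟫ • S x), T x⟫ = 0
    rw [hV]
    simp only [inner_smul_left, inner_sub_left, inner_self_eq_one h1 hx, conj_trivial]
    ring

/-- A field orthogonal to all normal fields is tangential. -/
theorem eq_inner_smul_of_forall_integral_eq_zero (hab : a < b) (hT : SmoothOn a b T)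
    (h1 : ∀ x ∈ Icc a b, ‖T x‖ = 1) {Q : ℝ → EuclideanSpace ℝ (Fin n)}
    (hQ : ContinuousOn Q (Icc a b))
    (H : ∀ V ∈ normalFields a b T, ∫ x in a..b, ⟪Q x, V x⟫ = 0) :
    ∀ x ∈ Icc a b, Q x = ⟪Q x, T x⟫ • T x := by
  have hTc : ContinuousOn T (Icc a b) := ContDiffOn.continuousOn hT
  have hc : ContinuousOn (fun x => Q x - ⟪Q x, T x⟫ • T x) (Icc a b) :=
    hQ.sub ((hQ.inner (𝕜 := ℝ) hTc).smul hTc)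
  refine fun x hx => sub_eq_zero.1
    (eqOn_zero_of_forall_integral_smul_eq_zero hab hc (fun φ hφ hφc hφs => ?_) x hx)
  refine ext_inner_left ℝ fun e => ?_
  -- The normal projection is self-adjoint, so it can be moved from `Q` to the test field.
  obtain ⟨V, hV, hVe⟩ := exists_normalField hab hT h1 hφ hφc hφs e
  rw [inner_zero_right, inner_integral_smul hab hφ.continuous hc e, ← H V hV]
  refine intervalIntegral.integral_congr fun y _ => ?_
  simp only [hVe, inner_smul_right, inner_sub_right, inner_sub_left, inner_smul_left, conj_trivial,
    real_inner_comm (T y) e]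
  ring

/-- Integration of normal fields. -/
noncomputable def normalIntegral (a b : ℝ) (T : ℝ → EuclideanSpace ℝ (Fin n)) :
    normalFields a b T →ₗ[ℝ] EuclideanSpace ℝ (Fin n) where
  toFun V := ∫ x in a..b, V.1 x
  map_add' V W := intervalIntegral.integral_add (V.2.1.continuous.intervalIntegrable _ _)
    (W.2.1.continuous.intervalIntegrable _ _)
  map_smul' c V := intervalIntegral.integral_smul c V.1

/-- Along a curve which is not straight, the integrals of normal fields exhaust the space. -/
theorem normalIntegral_surjective (hab : a < b) (hT : SmoothOn a b T)
    (h1 : ∀ x ∈ Icc a b, ‖T x‖ = 1) {x : ℝ} (hx : x ∈ Icc a b) (hx' : derivOn a b T x ≠ 0) :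
    Function.Surjective (normalIntegral a b T) := by
  rw [← LinearMap.range_eq_top, ← Submodule.orthogonal_eq_bot_iff, Submodule.eq_bot_iff]
  intro c hc
  have h2 : ∀ y ∈ Icc a b, c = ⟪c, T y⟫ • T y := by
    refine eq_inner_smul_of_forall_integral_eq_zero hab hT h1 continuousOn_const fun V hV => ?_
    have h3 := (Submodule.mem_orthogonal' _ c).1 hc _ (LinearMap.mem_range_self _ ⟨V, hV⟩)
    rw [← h3]
    exact (innerSL ℝ c).intervalIntegral_comp_comm (hV.1.continuous.intervalIntegrable _ _)
  -- Differentiate `c = ⟪c, T⟫ T` and pair with `T'`: then `⟪c, T⟫ |T'|² = 0` at `x`, which forces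
  -- `c = 0`.
  have hd := hT.hasDerivWithinAt hx
  have h4 := derivOn_eq hab hx
    (((hasDerivWithinAt_const x (Icc a b) c).inner ℝ hd).smul hd)
  have h5 : derivOn a b (fun y => ⟪c, T y⟫ • T y) x = 0 := by
    rw [← derivOn_congr (f := fun _ => c) h2 hx]
    exact derivOn_eq hab hx (hasDerivWithinAt_const _ _ _)
  have h6 := congrArg (fun v => ⟪v, derivOn a b T x⟫) (h4.symm.trans h5)
  have h7 := inner_derivOn_self hab hT h1 hx
  rw [real_inner_comm] at h7
  simp only [inner_add_left, inner_smul_left, conj_trivial, h7, inner_zero_left, mul_zero, add_zero,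
    mul_eq_zero, inner_self_eq_zero, hx', or_false] at h6
  rw [h2 x hx, h6, zero_smul]

/-- The factor normalizing `e + u` for a unit vector `e` and `u ⟂ e`. -/
noncomputable def normalizer (u : EuclideanSpace ℝ (Fin n)) : ℝ := (√(1 + ‖u‖ ^ 2))⁻¹

theorem contDiff_normalizer : ContDiff ℝ ∞ (normalizer (n := n)) := by
  have h : ∀ u : EuclideanSpace ℝ (Fin n), 0 < 1 + ‖u‖ ^ 2 := fun u => by positivity
  exact ((contDiff_const.add (contDiff_norm_sq ℝ)).sqrt fun u => (h u).ne').inv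
    fun u => (Real.sqrt_pos.2 (h u)).ne'

theorem normalizer_zero : normalizer (0 : EuclideanSpace ℝ (Fin n)) = 1 := by
  simp [normalizer]

theorem norm_normalizer_smul {e u : EuclideanSpace ℝ (Fin n)} (he : ‖e‖ = 1) (hu : ⟪u, e⟫ = 0) :
    ‖normalizer u • (e + u)‖ = 1 := by
  have h1 : ‖e + u‖ = √(1 + ‖u‖ ^ 2) := by
    rw [← Real.sqrt_sq (norm_nonneg (e + u)), norm_add_sq_real, real_inner_comm, hu, he]
    norm_num
  have h2 : 0 < √(1 + ‖u‖ ^ 2) := Real.sqrt_pos.2 (by positivity)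
  rw [norm_smul, h1, normalizer, Real.norm_of_nonneg (by positivity), inv_mul_cancel₀ h2.ne']

/-- The change of the unit vector `e` when `u` is added and the sum is normalized. -/
noncomputable def unitShift (e u : EuclideanSpace ℝ (Fin n)) : EuclideanSpace ℝ (Fin n) :=
  (normalizer u - 1) • e + normalizer u • u

/-- Working with the change of the tangent makes it vanish outside the support of `u`; its primitive
is the displacement of the curve. -/
theorem unitShift_zero (e : EuclideanSpace ℝ (Fin n)) : unitShift e 0 = 0 := by
  simp [unitShift, normalizer_zero]

theorem norm_add_unitShift {e u : EuclideanSpace ℝ (Fin n)} (he : ‖e‖ = 1) (hu : ⟪u, e⟫ = 0) :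
    ‖e + unitShift e u‖ = 1 := by
  rw [← norm_normalizer_smul he hu, unitShift]
  congr 1
  module

/-- The normalizing factor depends on `‖u‖²`, so normalization has no first-order effect at `u = 0`.
-/
theorem hasDerivAt_unitShift (e : EuclideanSpace ℝ (Fin n)) {u : ℝ → EuclideanSpace ℝ (Fin n)}
    {u' : EuclideanSpace ℝ (Fin n)} (hu : HasDerivAt u u' 0) (h0 : u 0 = 0) :
    HasDerivAt (fun t => unitShift e (u t)) u' 0 := by
  have h1 : HasDerivAt (fun t => normalizer (u t)) 0 0 := by
    have h2 : HasDerivAt (fun t => √(1 + ‖u t‖ ^ 2)) 0 0 := by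
      have := (hu.norm_sq.const_add 1).sqrt (by simp [h0])
      simpa [h0] using this
    refine (h2.inv (by simp [h0])).congr_deriv (by simp)
  have := ((h1.sub_const 1).smul_const e).add (h1.smul hu)
  exact this.congr_deriv (by simp [h0, normalizer_zero])

/-- A linear family of normal fields with prescribed integrals, smooth jointly in the parameters
and the variable. -/
theorem exists_normal_family (W : EuclideanSpace ℝ (Fin n) →ₗ[ℝ] normalFields a b T)
    (hW : ∀ e, normalIntegral a b T (W e) = e) (V : normalFields a b T)
    (hV : normalIntegral a b T V = 0) :
    ∃ w : ℝ → ℝ × EuclideanSpace ℝ (Fin n) →L[ℝ] EuclideanSpace ℝ (Fin n),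
      ContDiff ℝ ∞ (fun q : (ℝ × EuclideanSpace ℝ (Fin n)) × ℝ => w q.2 q.1) ∧
      (∃ K, IsCompact K ∧ K ⊆ Ioo a b ∧ ∀ x ∉ K, w x = 0) ∧
      (∀ x ∈ Icc a b, ∀ p, ⟪w x p, T x⟫ = 0) ∧ (∀ p, ∫ x in a..b, w x p = p.2) ∧
      ∀ x, w x (1, 0) = V.1 x := by
  set e := EuclideanSpace.basisFun (Fin n) ℝ
  set K : Set ℝ := tsupport V.1 ∪ ⋃ i, tsupport (W (e i)).1
  -- The family is `(t, s) ↦ tV + W s`. Expanding `s` in a basis involves finitely many fields,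
  -- which yields joint smoothness and a common compact support.
  let L : ℝ × EuclideanSpace ℝ (Fin n) →ₗ[ℝ] normalFields a b T :=
    (LinearMap.toSpanSingleton ℝ _ V).coprod W
  let w : ℝ → ℝ × EuclideanSpace ℝ (Fin n) →L[ℝ] EuclideanSpace ℝ (Fin n) := fun x =>
    LinearMap.toContinuousLinearMap ((LinearMap.proj x).comp ((normalFields a b T).subtype.comp L))
  have hw_eq : ∀ p x, w x p = (L p).1 x := fun p x => rfl
  have hWsum : ∀ s x, (W s).1 x = ∑ i, s i • (W (e i)).1 x := fun s x => by
    have hs : s = ∑ i, s i • e i := (e.sum_repr s).symm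
    conv_lhs => rw [hs, map_sum, Submodule.coe_sum, Finset.sum_apply]
    exact Finset.sum_congr rfl fun i _ => by rw [map_smul]; rfl
  have hw_apply : ∀ p x, w x p = p.1 • V.1 x + ∑ i, p.2 i • (W (e i)).1 x := fun p x => by
    rw [← hWsum]; rfl
  refine ⟨w, ?_, ⟨K, ?_, ?_, fun x hx => ?_⟩, fun x hx p => (L p).2.2.2.2 x hx, fun p => ?_,
    fun x => ?_⟩
  · have heq : (fun q : (ℝ × EuclideanSpace ℝ (Fin n)) × ℝ => w q.2 q.1)
        = fun q => q.1.1 • V.1 q.2 + ∑ i, q.1.2 i • (W (e i)).1 q.2 := funext fun q => hw_apply _ _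
    rw [heq]
    have hfst : ContDiff ℝ ∞ fun q : (ℝ × EuclideanSpace ℝ (Fin n)) × ℝ => q.1.1 :=
      contDiff_fst.fst
    refine (hfst.smul (V.2.1.comp contDiff_snd)).add (ContDiff.sum fun i _ => ?_)
    have hsnd : ContDiff ℝ ∞ fun q : (ℝ × EuclideanSpace ℝ (Fin n)) × ℝ => q.1.2 :=
      contDiff_fst.snd
    exact (contDiff_euclidean.1 hsnd i).smul ((W (e i)).2.1.comp contDiff_snd)
  · exact V.2.2.1.isCompact.union (isCompact_iUnion fun i => (W (e i)).2.2.1.isCompact)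
  · exact union_subset V.2.2.2.1 (iUnion_subset fun i => (W (e i)).2.2.2.1)
  · refine ContinuousLinearMap.ext fun p => ?_
    rw [hw_apply, image_eq_zero_of_notMem_tsupport fun h => hx (Or.inl h), smul_zero, zero_add]
    refine Finset.sum_eq_zero fun i _ => ?_
    rw [image_eq_zero_of_notMem_tsupport fun h => hx (Or.inr (mem_iUnion.2 ⟨i, h⟩)), smul_zero]
  · have : normalIntegral a b T (L p) = p.2 := by
      simp only [L, LinearMap.coprod_apply, LinearMap.toSpanSingleton_apply]
      rw [map_add, map_smul, hV, smul_zero, zero_add, hW]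
    exact this
  · simp [hw_apply]

/-- A linear family of normal fields with prescribed integrals gives rise to a variation through
arc-length parametrized curves. -/
theorem exists_isVariation_of_family (hab : a < b) {γ : ℝ → EuclideanSpace ℝ (Fin n)}
    (hγ : IsArcLengthCurve a b γ) (hTγ : derivOn a b γ = T)
    {w : ℝ → ℝ × EuclideanSpace ℝ (Fin n) →L[ℝ] EuclideanSpace ℝ (Fin n)}
    (hw : ContDiff ℝ ∞ (fun q : (ℝ × EuclideanSpace ℝ (Fin n)) × ℝ => w q.2 q.1))
    {K : Set ℝ} (hK : IsCompact K) (hKab : K ⊆ Ioo a b) (hw0 : ∀ x ∉ K, w x = 0)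
    (hwT : ∀ x ∈ Icc a b, ∀ p, ⟪w x p, T x⟫ = 0) (hwint : ∀ p, ∫ x in a..b, w x p = p.2) :
    ∃ ε Γ, IsVariation a b γ ε Γ ∧ (∀ t ∈ Icc (-ε) ε, ∀ x ∈ Icc a b, ‖derivOn a b (Γ t) x‖ = 1) ∧
      ∀ x ∈ Icc a b, HasDerivAt (fun t => derivOn a b (Γ t) x) (w x (1, 0)) 0 := by
  have hT : SmoothOn a b T := hTγ ▸ hγ.smooth.derivOn hab
  have hT1 : ∀ x ∈ Icc a b, ‖T x‖ = 1 := hTγ ▸ hγ.unit_speed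
  obtain ⟨S, hS, hST⟩ := hT.exists_contDiff_eqOn hab hK hKab
  obtain ⟨g, hg_eq⟩ : ∃ g : ℝ × EuclideanSpace ℝ (Fin n) → ℝ → EuclideanSpace ℝ (Fin n),
    ∀ p x, g p x = unitShift (S x) (w x p) := ⟨_, fun _ _ => rfl⟩
  have hg : ContDiff ℝ ∞ fun q : (ℝ × EuclideanSpace ℝ (Fin n)) × ℝ => g q.1 q.2 := by
    simp only [hg_eq]
    have hn := contDiff_normalizer.comp hw
    exact ((hn.sub contDiff_const).smul (hS.comp contDiff_snd)).add (hn.smul hw)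
  have hg0 : ∀ p, ∀ x ∉ K, g p x = 0 := fun p x hx => by
    rw [hg_eq, hw0 x hx, zero_apply, unitShift_zero]
  have hgz : ∀ x, g 0 x = 0 := fun x => by rw [hg_eq, map_zero, unitShift_zero]
  have hgc : ∀ p, Continuous (g p) := fun p => hg.continuous.comp (Continuous.prodMk_right p)
  have hgd : ∀ x, ∀ p : ℝ → ℝ × EuclideanSpace ℝ (Fin n), ∀ p', HasDerivAt p p' 0 → p 0 = 0 →
      HasDerivAt (fun t => g (p t) x) (w x p') 0 := fun x p p' hp hp0 => by
    simp only [hg_eq]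
    exact hasDerivAt_unitShift _ ((w x).hasFDerivAt.comp_hasDerivAt (0 : ℝ) hp)
      (by rw [hp0, map_zero])
  obtain ⟨C, hC_eq⟩ : ∃ C : ℝ × EuclideanSpace ℝ (Fin n) → ℝ → EuclideanSpace ℝ (Fin n),
    ∀ p x, C p x = ∫ y in a..x, g p y := ⟨_, fun _ _ => rfl⟩
  have hC : ContDiff ℝ ∞ fun q : (ℝ × EuclideanSpace ℝ (Fin n)) × ℝ => C q.1 q.2 := by
    simp only [hC_eq]
    exact contDiff_integral_of_compact_support hg hK hg0 a
  -- The displacement of the end point `b` must vanish. Its derivative at `0` is `p ↦ ∫ w p = p.2`: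
  -- the identity in `s`, zero in `t`.
  have hΦ : ContDiff ℝ ∞ fun p => C p b := hC.comp (contDiff_id.prodMk contDiff_const)
  have hCz : ∀ x, C 0 x = 0 := fun x => by simp [hC_eq, hgz]
  have hΦ' : fderiv ℝ (fun p => C p b) 0 = ContinuousLinearMap.snd ℝ ℝ _ := by
    refine ContinuousLinearMap.ext fun p => ?_
    have hline : HasDerivAt (fun t : ℝ => t • p) p 0 := by
      simpa using (hasDerivAt_id (0 : ℝ)).smul_const p
    have hd1 : HasDerivAt (fun t : ℝ => C (t • p) b) (fderiv ℝ (fun p => C p b) 0 p) 0 := by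
      have h := ((hΦ.differentiable (by simp)) ((0 : ℝ) • p)).hasFDerivAt.comp_hasDerivAt 0 hline
      rwa [zero_smul] at h
    have hd2 := hasDerivAt_integral_of_contDiffOn (f := fun t x => g (t • p) x)
      (g := fun x => w x p) one_pos hab
      ((hg.comp ((contDiff_fst.smul contDiff_const).prodMk contDiff_snd)).contDiffOn)
      (fun x _ => hgd x _ p hline (zero_smul _ _))
    simp only [← hC_eq, hwint] at hd2
    exact hd1.unique hd2
  obtain ⟨ε, hε, s, hs, hs0, hs', hsol⟩ := exists_smooth_solution hΦ (hCz b) hΦ'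
  have hp0 : ((0 : ℝ), s 0) = 0 := by rw [hs0]; rfl
  have hderiv : ∀ t, ∀ x ∈ Icc a b, derivOn a b (fun x => γ x + C (t, s t) x) x
      = T x + g (t, s t) x := fun t x hx => by
    have h1 : HasDerivAt (C (t, s t)) (g (t, s t) x) x := by
      rw [funext (hC_eq (t, s t))]
      exact intervalIntegral.integral_hasDerivAt_right ((hgc _).intervalIntegrable _ _)
        ((hgc _).stronglyMeasurableAtFilter _ _) (hgc _).continuousAt
    rw [← hTγ]
    exact derivOn_eq hab hx ((hγ.smooth.hasDerivWithinAt hx).add h1.hasDerivWithinAt)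
  obtain ⟨δ, hδ, hmargin⟩ := exists_margin hK hKab
  refine ⟨ε, fun t x => γ x + C (t, s t) x, ⟨hε, ?_, fun x _ => ?_, δ, hδ, fun t ht x hx hx' => ?_⟩,
    fun t ht x hx => ?_, fun x hx => ?_⟩
  · refine (hγ.smooth.comp contDiffOn_snd fun p hp => hp.2).add ?_
    exact hC.comp_contDiffOn ((contDiffOn_fst.prodMk
      (hs.comp contDiffOn_fst fun p hp => hp.1)).prodMk contDiffOn_snd)
  · simp only [hp0, hCz, add_zero]
  · rw [add_eq_left, hC_eq]
    rcases hx' with hx' | hx'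
    · refine (intervalIntegral.integral_congr fun y hy => ?_).trans
        intervalIntegral.integral_zero
      rw [uIcc_of_le hx.1] at hy
      exact hg0 _ y (hmargin y (Or.inl (hy.2.trans hx')))
    · have h1 : (∫ y in a..x, g (t, s t) y) + ∫ y in x..b, g (t, s t) y = C (t, s t) b := by
        rw [hC_eq]
        exact intervalIntegral.integral_add_adjacent_intervals ((hgc _).intervalIntegrable _ _)
          ((hgc _).intervalIntegrable _ _)
      have h2 : ∫ y in x..b, g (t, s t) y = 0 := by
        refine (intervalIntegral.integral_congr fun y hy => ?_).trans
          intervalIntegral.integral_zero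
        rw [uIcc_of_le hx.2] at hy
        exact hg0 _ y (hmargin y (Or.inr (hx'.trans hy.1)))
      rwa [h2, add_zero, hsol t ht] at h1
  · rw [hderiv t x hx]
    by_cases hxK : x ∈ K
    · rw [hg_eq, hST hxK]
      exact norm_add_unitShift (hT1 x hx) (hwT x hx _)
    · rw [hg0 _ x hxK, add_zero]
      exact hT1 x hx
  -- Since `s'(0) = 0`, the correction does not affect the velocity of the tangent.
  · simp only [hderiv _ x hx]
    exact (hgd x _ _ ((hasDerivAt_id (0 : ℝ)).prodMk hs') hp0).const_add _

/-- Elastic curves solve the pendulum equation. -/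
theorem IsElastic.exists_pendulumEq (hab : a < b) {γ : ℝ → EuclideanSpace ℝ (Fin n)} {ϱ : ℝ → ℝ}
    (hγ : IsArcLengthCurve a b γ) (hϱ : SmoothOn a b ϱ) (h : IsElastic a b ϱ γ) :
    ∃ A, PendulumEq a b ϱ (derivOn a b γ) A := by
  set T := derivOn a b γ
  have hT : SmoothOn a b T := hγ.smooth.derivOn hab
  have h1 : ∀ x ∈ Icc a b, ‖T x‖ = 1 := hγ.unit_speed
  by_cases hstraight : ∀ x ∈ Icc a b, derivOn a b T x = 0
  · refine ⟨0, fun x hx => ?_⟩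
    have : derivOn a b (derivOn a b T) x = 0 := by
      rw [derivOn_congr (g := fun _ => 0) hstraight hx]
      exact derivOn_eq hab hx (hasDerivWithinAt_const _ _ _)
    simp [this, hstraight x hx]
  push Not at hstraight
  obtain ⟨x₀, hx₀, hne⟩ := hstraight
  obtain ⟨W, hW⟩ := (normalIntegral a b T).exists_rightInverse_of_surjective
    (LinearMap.range_eq_top.2 (normalIntegral_surjective hab hT h1 hx₀ hne))
  have hW' : ∀ e, normalIntegral a b T (W e) = e := fun e => LinearMap.congr_fun hW e
  -- With zero multiplier the augmented energy is the bending energy itself.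
  set Q := energyGradient a b ϱ (fun _ => 0) T
  have hQs : SmoothOn a b Q := smoothOn_energyGradient hab hϱ contDiffOn_const hT
  have hQ : ContinuousOn Q (Icc a b) := ContDiffOn.continuousOn hQs
  have hint : ∀ V : normalFields a b T,
      IntervalIntegrable (fun x => ⟪Q x, V.1 x⟫) volume a b := fun V =>
    (hQ.inner V.2.1.continuous.continuousOn).intervalIntegrable_of_Icc hab.le
  have hcrit : ∀ V : normalFields a b T, normalIntegral a b T V = 0 →
      ∫ x in a..b, ⟪Q x, V.1 x⟫ = 0 := by
    intro V hV
    obtain ⟨w, hw, ⟨K, hK, hKab, hw0⟩, hwT, hwint, hwV⟩ := exists_normal_family W hW' V hV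
    obtain ⟨ε, Γ, hΓ, hu, hD⟩ :=
      exists_isVariation_of_family hab hγ rfl hw hK hKab hw0 hwT hwint
    simp only [hwV] at hD
    refine (hΓ.hasDerivAt_augmentedEnergy hab hγ hϱ contDiffOn_const hD).unique ?_
    refine (h ε Γ hΓ hu).congr_of_eventuallyEq (Eventually.of_forall fun t => ?_)
    simp only [augmentedEnergy, zero_mul, intervalIntegral.integral_zero, mul_zero,
      add_zero]
  let ℓ : normalFields a b T →ₗ[ℝ] ℝ :=
    { toFun := fun V => ∫ x in a..b, ⟪Q x, V.1 x⟫
      map_add' := fun U V => by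
        rw [← intervalIntegral.integral_add (hint U) (hint V)]
        simp [inner_add_right]
      map_smul' := fun c V => by
        simp [inner_smul_right] }
  -- `B` is the Riesz vector of `ℓ ∘ W`. As `V - W (∫ V)` has zero integral, `ℓ V = ⟪B, ∫ V⟫` for
  -- every normal field.
  set B := (InnerProductSpace.toDual ℝ (EuclideanSpace ℝ (Fin n))).symm
    (LinearMap.toContinuousLinearMap (ℓ.comp W))
  have hB : ∀ e, ⟪B, e⟫ = ℓ (W e) := fun e => by
    rw [InnerProductSpace.toDual_symm_apply]
    rfl
  have hℓ : ∀ V : normalFields a b T, ℓ V = ⟪B, normalIntegral a b T V⟫ := fun V => by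
    have h2 := hcrit (V - W (normalIntegral a b T V)) (by rw [map_sub, hW', sub_self])
    have h3 : ℓ (V - W (normalIntegral a b T V)) = 0 := h2
    rw [map_sub, ← hB, sub_eq_zero] at h3
    exact h3
  have htan := eq_inner_smul_of_forall_integral_eq_zero hab hT h1 (hQ.sub continuousOn_const)
    (Q := fun x => Q x - B) fun V hV => by
      have h2 : ∫ x in a..b, ⟪B, V x⟫ = ⟪B, ∫ x in a..b, V x⟫ :=
        (innerSL ℝ B).intervalIntegral_comp_comm (hV.1.continuous.intervalIntegrable _ _)
      simp only [inner_sub_left]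
      rw [intervalIntegral.integral_sub (hint ⟨V, hV⟩)
        ((continuous_const.inner hV.1.continuous).intervalIntegrable _ _), h2, sub_eq_zero]
      exact hℓ ⟨V, hV⟩
  refine ⟨-B, fun x hx => ?_⟩
  have h2 := htan x hx
  have h3 := inner_self_eq_one h1 hx
  have h4 := inner_derivOn_self hab hT h1 hx
  simp only [Q, energyGradient, derivOn_smul_derivOn hab hϱ hT hx, inner_sub_left, inner_add_left,
    inner_smul_left, conj_trivial, h3, h4] at h2
  rw [← sub_eq_zero] at h2 ⊢
  rw [← neg_eq_zero, ← h2, inner_neg_left]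
  module

end NormalFields

/-! ### Curvature functions and the planar pendulum -/

section Planar

variable {n : ℕ} {a b : ℝ} {γ : ℝ → EuclideanSpace ℝ (Fin n)} {ϱ : ℝ → ℝ}

theorem IsCurvatureFunction.inner_self_eq {κ : ℝ → EuclideanSpace ℝ (Fin (n - 1))}
    (hκ : IsCurvatureFunction a b γ κ) {x : ℝ} (hx : x ∈ Icc a b) :
    ⟪derivOn a b (unitTangent a b γ) x, derivOn a b (unitTangent a b γ) x⟫ = ⟪κ x, κ x⟫ := by
  obtain ⟨N, hN, h⟩ := hκ.exists_frame
  rw [h x hx, inner_neg_neg, (hN.orthonormal x hx).inner_sum, PiLp.inner_apply]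
  simp [pow_two]

theorem inner_basis_zero_one (e : OrthonormalBasis (Fin 2) ℝ (EuclideanSpace ℝ (Fin n))) :
    ⟪e 0, e 0⟫ = 1 ∧ ⟪e 1, e 1⟫ = 1 ∧ ⟪e 0, e 1⟫ = 0 ∧ ⟪e 1, e 0⟫ = 0 := by
  refine ⟨?_, ?_, ?_, ?_⟩ <;> rw [e.inner_eq_ite] <;> simp

/-- In terms of the tangent angle, the pendulum equation is the damped pendulum equation. -/
theorem IsTangentAngle.pendulumEq_iff (hab : a < b) (hϱ : IsStiffness a b ϱ)
    {e : OrthonormalBasis (Fin 2) ℝ (EuclideanSpace ℝ (Fin n))} {θ : ℝ → ℝ}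
    (hθ : IsTangentAngle a b γ e θ) (q : ℝ) :
    PendulumEq a b ϱ (unitTangent a b γ) (-q • e 1) ↔ DampedPendulumEq a b ϱ q θ := by
  obtain ⟨e00, e11, e01, e10⟩ := inner_basis_zero_one e
  set T := unitTangent a b γ
  -- `U` is the derivative of `T` with respect to `θ`, a unit normal. Both sides of the equation
  -- become multiples of it: `(ϱθ')' U` and `-q sin θ U`.
  let U : ℝ → EuclideanSpace ℝ (Fin n) := fun x => Real.cos (θ x) • e 0 + Real.sin (θ x) • e 1
  have hd : ∀ x ∈ Icc a b, HasDerivWithinAt θ (derivOn a b θ x) (Icc a b) x := fun x hx =>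
    hθ.smooth.hasDerivWithinAt hx
  have hT' : ∀ x ∈ Icc a b, derivOn a b T x = derivOn a b θ x • U x := fun x hx => by
    rw [derivOn_congr hθ.eq hx]
    refine (derivOn_eq hab hx (((hd x hx).sin.smul_const (e 0)).sub
      ((hd x hx).cos.smul_const (e 1)))).trans ?_
    simp only [U]
    module
  have hT'' : ∀ x ∈ Icc a b, derivOn a b (derivOn a b T) x
      = derivOn a b (derivOn a b θ) x • U x - (derivOn a b θ x) ^ 2 •
        (Real.sin (θ x) • e 0 - Real.cos (θ x) • e 1) := fun x hx => by
    rw [derivOn_congr hT' hx]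
    have hU : HasDerivWithinAt U _ (Icc a b) x :=
      ((hd x hx).cos.smul_const (e 0)).add ((hd x hx).sin.smul_const (e 1))
    refine (derivOn_eq hab hx
      (((hθ.smooth.derivOn hab).hasDerivWithinAt hx).smul hU)).trans ?_
    simp only [U]
    module
  refine forall₂_congr fun x hx => ?_
  have hpos := hϱ.pos x hx
  have hsc := Real.sin_sq_add_cos_sq (θ x)
  have hTx : T x = Real.sin (θ x) • e 0 - Real.cos (θ x) • e 1 := hθ.eq x hx
  rw [hT'' x hx, hT' x hx, hTx]
  set s := Real.sin (θ x)
  set c := Real.cos (θ x)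
  set θ₁ := derivOn a b θ x
  set θ₂ := derivOn a b (derivOn a b θ) x
  set ϱ₁ := derivOn a b ϱ x
  have hU : U x = c • e 0 + s • e 1 := rfl
  have hUU : ⟪U x, U x⟫ = 1 := by
    simp only [hU, inner_add_left, inner_add_right, inner_smul_left, inner_smul_right, e00, e11,
      e01, e10, conj_trivial]
    linarith
  have h1 : ⟪θ₂ • U x - θ₁ ^ 2 • (s • e 0 - c • e 1), s • e 0 - c • e 1⟫ = -θ₁ ^ 2 := by
    simp only [hU, inner_add_left, inner_sub_left, inner_sub_right, inner_smul_left,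
      inner_smul_right, e00, e11, e01, e10, conj_trivial]
    linear_combination (-θ₁ ^ 2) * hsc
  have h2 : ⟪-q • e 1, s • e 0 - c • e 1⟫ = q * c := by
    simp only [inner_sub_right, inner_smul_left, inner_smul_right, e11, e10, conj_trivial]
    ring
  have h3 : -q • e 1 - (q * c) • (s • e 0 - c • e 1) = (-q * s) • U x := by
    have : e 1 = (s ^ 2 + c ^ 2) • e 1 := by rw [hsc, one_smul]
    rw [hU]
    nth_rw 1 [this]
    module
  have h4 : ϱ x • (θ₂ • U x - θ₁ ^ 2 • (s • e 0 - c • e 1)) + ϱ₁ • θ₁ • U x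
      - (ϱ x * -θ₁ ^ 2) • (s • e 0 - c • e 1) = (ϱ x * θ₂ + ϱ₁ * θ₁) • U x := by module
  rw [h1, h2, h3, h4]
  have h5 : U x ≠ 0 := fun h => by simp [h] at hUU
  rw [smul_left_injective ℝ h5 |>.eq_iff]
  constructor
  · intro h
    field_simp
    linarith
  · intro h
    rw [h]
    field_simp
    ring

/-- From `ϱ = l²` and `q = g l` follow `ϱ'/ϱ = 2 l'/l` and `q/ϱ = g/l`. -/
theorem dampedPendulumEq_iff_variableLength (hab : a < b) {l g θ : ℝ → ℝ} {q : ℝ}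
    (hl : SmoothOn a b l) (h : ∀ x ∈ Icc a b, 0 < l x ∧ ϱ x = l x ^ 2 ∧ q = g x * l x) :
    DampedPendulumEq a b ϱ q θ ↔ VariableLengthPendulumEq a b l g θ := by
  refine forall₂_congr fun x hx => ?_
  obtain ⟨h1, h2, h3⟩ := h x hx
  have h4 : derivOn a b ϱ x = 2 * l x * derivOn a b l x := by
    rw [derivOn_congr (g := fun y => l y ^ 2) (fun y hy => (h y hy).2.1) hx]
    refine (derivOn_eq hab hx ((hl.hasDerivWithinAt hx).fun_pow 2)).trans ?_
    norm_num
  have h5 : q / l x ^ 2 = g x / l x := by rw [h3]; field_simp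
  have h6 : 2 * l x * derivOn a b l x / l x ^ 2 = 2 * (derivOn a b l x / l x) := by field_simp
  rw [h2, h4, h5, h6]

theorem exists_sin_cos_eq {x y : ℝ} (h : x ^ 2 + y ^ 2 = 1) :
    ∃ θ, Real.sin θ = x ∧ Real.cos θ = y := by
  have hn : ‖(⟨y, x⟩ : ℂ)‖ = 1 := by
    rw [Complex.norm_def, Complex.normSq_mk, Real.sqrt_eq_one]
    linarith
  have h0 : (⟨y, x⟩ : ℂ) ≠ 0 := fun h => by simp [h] at hn
  exact ⟨Complex.arg ⟨y, x⟩, by rw [Complex.sin_arg, hn, div_one],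
    by rw [Complex.cos_arg h0, hn, div_one]⟩

/-- A smooth curve in the unit circle has a smooth angle function. -/
theorem exists_smooth_angle (hab : a < b) {p r : ℝ → ℝ} (hp : SmoothOn a b p)
    (hr : SmoothOn a b r) (h1 : ∀ x ∈ Icc a b, p x ^ 2 + r x ^ 2 = 1) :
    ∃ θ, SmoothOn a b θ ∧ ∀ x ∈ Icc a b, Real.sin (θ x) = p x ∧ Real.cos (θ x) = r x := by
  have hp' := hp.derivOn hab
  have hr' := hr.derivOn hab
  have ha : a ∈ Icc a b := ⟨le_rfl, hab.le⟩
  obtain ⟨θ₀, hs₀, hc₀⟩ := exists_sin_cos_eq (h1 a ha)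
  -- `v` is the angular speed of `(r, p)`. It is extended constantly beyond `[a, b]`, so that its
  -- primitive is differentiable at the end points too.
  set v : ℝ → ℝ := fun x => derivOn a b p x * r x - p x * derivOn a b r x
  have hv : SmoothOn a b v := (ContDiffOn.mul hp' hr).sub (ContDiffOn.mul hp hr')
  set v' : ℝ → ℝ := IccExtend hab.le ((Icc a b).domRestrict v)
  have hv' : Continuous v' :=
    (continuousOn_iff_continuous_domRestrict.1 (ContDiffOn.continuousOn hv)).Icc_extend'
  set θ : ℝ → ℝ := fun x => θ₀ + ∫ y in a..x, v' y
  have hd : ∀ x ∈ Icc a b, HasDerivWithinAt θ (v x) (Icc a b) x := fun x hx => by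
    have := (intervalIntegral.integral_hasDerivAt_right (hv'.intervalIntegrable a x)
      (hv'.stronglyMeasurableAtFilter _ _) hv'.continuousAt).const_add θ₀
    have h2 : v' x = v x := IccExtend_of_mem _ _ hx
    rw [h2] at this
    exact this.hasDerivWithinAt
  have hθ : SmoothOn a b θ := (contDiffOn_infty_iff_derivWithin (uniqueDiffOn_Icc hab)).2
    ⟨fun x hx => (hd x hx).differentiableWithinAt,
      ContDiffOn.congr hv fun x hx => derivOn_eq hab hx (hd x hx)⟩
  refine ⟨θ, hθ, ?_⟩
  -- This is the inner product of two unit vectors. It is constant with value `1` at `a`, and inner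
  -- product `1` forces them to coincide.
  have hF : SmoothOn a b fun x => p x * Real.sin (θ x) + r x * Real.cos (θ x) :=
    (ContDiffOn.mul hp (ContDiffOn.sin hθ)).add (ContDiffOn.mul hr (ContDiffOn.cos hθ))
  have hF' : ∀ x ∈ Icc a b,
      derivOn a b (fun x => p x * Real.sin (θ x) + r x * Real.cos (θ x)) x = 0 := fun x hx => by
    have hpx := hp.hasDerivWithinAt hx
    have hrx := hr.hasDerivWithinAt hx
    refine (derivOn_eq hab hx ((hpx.mul (hd x hx).sin).add (hrx.mul (hd x hx).cos))).trans ?_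
    have h2 : 2 * p x * derivOn a b p x + 2 * r x * derivOn a b r x = 0 := by
      have h3 := derivOn_eq hab hx ((hpx.fun_pow 2).add (hrx.fun_pow 2))
      have h4 : derivOn a b (fun y => p y ^ 2 + r y ^ 2) x = 0 := by
        rw [derivOn_congr (g := fun _ => (1 : ℝ)) h1 hx]
        exact derivOn_eq hab hx (hasDerivWithinAt_const _ _ _)
      have h5 := h3.symm.trans h4
      norm_num at h5
      linarith
    have h3 := h1 x hx
    simp only [v]
    linear_combination (- derivOn a b p x * Real.sin (θ x) - derivOn a b r x * Real.cos (θ x)) * h3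
      + (p x * Real.sin (θ x) + r x * Real.cos (θ x)) / 2 * h2
  intro x hx
  have h2 : p x * Real.sin (θ x) + r x * Real.cos (θ x) = 1 := by
    have hθa : θ a = θ₀ := by simp [θ]
    rw [hF.eq_left_of_derivOn_eq_zero hF' x hx, hθa, hs₀, hc₀]
    linarith [h1 a ha]
  have h3 := Real.sin_sq_add_cos_sq (θ x)
  have h4 := h1 x hx
  constructor <;> nlinarith [sq_nonneg (Real.sin (θ x) - p x), sq_nonneg (Real.cos (θ x) - r x)]

/-- Planar unit speed curves have a smooth tangent angle. -/
theorem IsArcLengthCurve.exists_isTangentAngle (hγ : IsArcLengthCurve a b γ) (hab : a < b)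
    (e : OrthonormalBasis (Fin 2) ℝ (EuclideanSpace ℝ (Fin n))) :
    ∃ θ, IsTangentAngle a b γ e θ := by
  have hT := hγ.smoothOn_unitTangent hab
  set T := unitTangent a b γ
  have hsum : ∀ x, T x = ⟪e 0, T x⟫ • e 0 + ⟪e 1, T x⟫ • e 1 := fun x => by
    rw [← Fin.sum_univ_two (fun i => ⟪e i, T x⟫ • e i), e.sum_repr']
  obtain ⟨θ, hθ, h⟩ := exists_smooth_angle hab (p := fun x => ⟪e 0, T x⟫)
    (r := fun x => -⟪e 1, T x⟫) (ContDiffOn.inner ℝ contDiffOn_const hT)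
    (ContDiffOn.neg (ContDiffOn.inner ℝ contDiffOn_const hT)) fun x hx => by
      have h2 := e.sum_sq_norm_inner_right (T x)
      rw [Fin.sum_univ_two, hγ.norm_unitTangent x hx] at h2
      simpa using h2
  refine ⟨θ, hθ, fun x hx => ?_⟩
  rw [(h x hx).1, (h x hx).2, neg_smul, sub_neg_eq_add]
  exact hsum x

/-- A unit vector in the direction of `A`, arbitrary if `A = 0`, is completed to a basis; the sign
convention makes `q = -‖A‖`. -/
theorem exists_orthonormalBasis_smul_eq (A : EuclideanSpace ℝ (Fin 2)) :
    ∃ (e : OrthonormalBasis (Fin 2) ℝ (EuclideanSpace ℝ (Fin 2))) (q : ℝ), A = -q • e 1 := by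
  obtain ⟨u, hu, hA⟩ : ∃ u : EuclideanSpace ℝ (Fin 2), ‖u‖ = 1 ∧ A = ‖A‖ • u := by
    by_cases hA : A = 0
    · exact ⟨EuclideanSpace.single 0 1, by simp, by simp [hA]⟩
    · have : ‖A‖ ≠ 0 := norm_ne_zero_iff.2 hA
      exact ⟨‖A‖⁻¹ • A, by rw [norm_smul, norm_inv, norm_norm, inv_mul_cancel₀ this],
        by rw [smul_smul, mul_inv_cancel₀ this, one_smul]⟩
  have ho : Orthonormal ℝ (({1} : Set (Fin 2)).domRestrict fun _ => u) :=
    ⟨fun _ => hu, fun i j hij => (hij (Subsingleton.elim i j)).elim⟩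
  obtain ⟨e, he⟩ := ho.exists_orthonormalBasis_extension_of_card_eq (by simp)
  exact ⟨e, -‖A‖, by rw [neg_neg, he 1 rfl]; exact hA⟩

/-- The two tangent fields agree on `[a, b]`, which suffices since derivatives are taken within that
interval. -/
theorem pendulumEq_unitTangent_iff (hγ : IsArcLengthCurve a b γ) {A : EuclideanSpace ℝ (Fin n)} :
    PendulumEq a b ϱ (unitTangent a b γ) A ↔ PendulumEq a b ϱ (derivOn a b γ) A := by
  have h1 : ∀ y ∈ Icc a b, derivOn a b (unitTangent a b γ) y = derivOn a b (derivOn a b γ) y :=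
    fun y hy => derivOn_congr hγ.unitTangent_eq hy
  refine forall₂_congr fun x hx => ?_
  rw [derivOn_congr h1 hx, h1 x hx, hγ.unitTangent_eq hx]

theorem isElastic_iff_exists_pendulumEq (hab : a < b) (hγ : IsArcLengthCurve a b γ)
    (hϱ : SmoothOn a b ϱ) :
    IsElastic a b ϱ γ ↔ ∃ A, PendulumEq a b ϱ (unitTangent a b γ) A := by
  refine ⟨fun h => ?_, fun ⟨A, hA⟩ => hA.isElastic hab hγ hϱ⟩
  obtain ⟨A, hA⟩ := h.exists_pendulumEq hab hγ hϱ
  exact ⟨A, (pendulumEq_unitTangent_iff hγ).2 hA⟩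

theorem isElastic_iff_exists_dampedPendulumEq {γ : ℝ → EuclideanSpace ℝ (Fin 2)} (hab : a < b)
    (hγ : IsArcLengthCurve a b γ) (hϱ : IsStiffness a b ϱ) :
    IsElastic a b ϱ γ ↔
      ∃ (e : OrthonormalBasis (Fin 2) ℝ (EuclideanSpace ℝ (Fin 2))) (θ : ℝ → ℝ) (q : ℝ),
        IsTangentAngle a b γ e θ ∧ DampedPendulumEq a b ϱ q θ := by
  rw [isElastic_iff_exists_pendulumEq hab hγ hϱ.smooth]
  constructor
  · rintro ⟨A, hA⟩
    obtain ⟨e, q, rfl⟩ := exists_orthonormalBasis_smul_eq A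
    obtain ⟨θ, hθ⟩ := hγ.exists_isTangentAngle hab e
    exact ⟨e, θ, q, hθ, (hθ.pendulumEq_iff hab hϱ q).1 hA⟩
  · rintro ⟨e, θ, q, hθ, hq⟩
    exact ⟨_, (hθ.pendulumEq_iff hab hϱ q).2 hq⟩

end Planar

end ElasticCurve

theorem theorem5p2 (n : ℕ) (hn : 2 ≤ n) (a b : ℝ) (hab : a < b)
    (γ : ℝ → EuclideanSpace ℝ (Fin n)) (hγ : IsArcLengthCurve a b γ)
    (ϱ : ℝ → ℝ) (hϱ : IsStiffness a b ϱ) :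
    -- elastic curves
    (IsElastic a b ϱ γ ↔ ∃ A, PendulumEq a b ϱ (unitTangent a b γ) A) ∧
    -- the pointwise multipliers
    (∀ Λ : ℝ → ℝ, SmoothOn a b Λ →
      (IsMultiplier a b ϱ γ Λ ↔ ∃ A, PendulumEq a b ϱ (unitTangent a b γ) A ∧
        ∀ x ∈ Icc a b, Λ x =
          1 / 2 * ϱ x * ⟪derivOn a b (unitTangent a b γ) x, derivOn a b (unitTangent a b γ) x⟫
            - ⟪A, unitTangent a b γ x⟫)) ∧
    (∀ κ, IsCurvatureFunction a b γ κ → ∀ A, ∀ x ∈ Icc a b,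
      1 / 2 * ϱ x * ⟪derivOn a b (unitTangent a b γ) x, derivOn a b (unitTangent a b γ) x⟫
          - ⟪A, unitTangent a b γ x⟫
        = 1 / 2 * ϱ x * ⟪κ x, κ x⟫ - ⟪A, unitTangent a b γ x⟫) ∧
    -- constant stiffness
    ((∃ c, ∀ x ∈ Icc a b, ϱ x = c) →
      ∀ Λ, IsMultiplier a b ϱ γ Λ → ∃ c, ∀ x ∈ Icc a b, Λ x = c) ∧
    -- the planar case
    (∀ (e : OrthonormalBasis (Fin 2) ℝ (EuclideanSpace ℝ (Fin n))) (θ : ℝ → ℝ),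
      IsTangentAngle a b γ e θ → ∀ q : ℝ,
        (PendulumEq a b ϱ (unitTangent a b γ) (-q • e 1) ↔ DampedPendulumEq a b ϱ q θ) ∧
        ∀ l g : ℝ → ℝ, SmoothOn a b l →
          (∀ x ∈ Icc a b, 0 < l x ∧ ϱ x = l x ^ 2 ∧ q = g x * l x) →
          (DampedPendulumEq a b ϱ q θ ↔ VariableLengthPendulumEq a b l g θ)) ∧
    (n = 2 → (IsElastic a b ϱ γ ↔
      ∃ (e : OrthonormalBasis (Fin 2) ℝ (EuclideanSpace ℝ (Fin n))) (θ : ℝ → ℝ) (q : ℝ),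
        IsTangentAngle a b γ e θ ∧ DampedPendulumEq a b ϱ q θ)) := by
  refine ⟨isElastic_iff_exists_pendulumEq hab hγ hϱ.smooth,
    fun Λ hΛ => isMultiplier_iff hab hγ hϱ.smooth hΛ,
    fun κ hκ A x hx => by rw [hκ.inner_self_eq hx],
    fun ⟨c, hc⟩ Λ hΛ => hΛ.eq_const hab hγ hϱ.smooth hc,
    fun e θ hθ q => ⟨hθ.pendulumEq_iff hab hϱ q,
      fun l g hl h => dampedPendulumEq_iff_variableLength hab hl h⟩,
    fun h2 => ?_⟩
  subst h2
  exact isElastic_iff_exists_dampedPendulumEq hab hγ hϱ
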